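/- Let $N\in 4\mathbb N$, let $\mathcal N=\{-N/2,\dots,N/2-1\}$, and let $u\in\mathbb C^{\mathcal N}$ be given by $u[n]=\sqrt N/2$ if $n=\pm N/4$ and $u[n]=0$ otherwise. For $\Xi=(\xi_1,\dots,\xi_M)\in\mathbb R^M$ let $A(\Xi)\in\mathbb C^{\mathcal N\times M}$ be the matrix with entries $A(\Xi)_{n,m}=\frac1{\sqrt N}e^{2\mathrm i\pi\xi_m n/N}$. For a noise level $\sigma\ge 0$ and a reconstructor $\mathcal R$ put $$J(\Xi)=\mathbb E_w\Big(\tfrac12\big\|\mathcal R(A(\Xi)^*u+w,\Xi)-u\big\|_2^2\Big),$$ where $w\sim\mathcal N(0,\sigma^2\mathrm{Id})$ is complex white Gaussian noise on $\mathbb C^M$ (independent circularly symmetric entries with $\mathbb E|w_m|^2=\sigma^2$). Let $J_1,J_2,J_3$ be the functions $J$ obtained from the back-projection $\mathcal R_1(y,\Xi)=A(\Xi)y$, the pseudo-inverse $\mathcal R_2(y,\Xi)=(A(\Xi)^*)^+y$, and the Tikhonov reconstructor $\mathcal R_3(y,\Xi)=(1+\lambda)\operatorname{argmin}_{f\in\mathbb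 C^{\mathcal N}}\frac12\|A(\Xi)^*f-y\|_2^2+\frac\lambda2\|f\|_2^2$ with an arbitrary $\lambda>0$. These functions are $N$-periodic in each $\xi_m$, and their local minimizers are counted in $[-N/2,N/2)^M$. Let $M=\lfloor\eta\sqrt N\rfloor$ with $\eta=\dfrac{\pi^2\sqrt2}{256\,(20+16\sigma^2)}$, and assume $M\ge 1$. Then each of $J_1$, $J_2$, $J_3$ has more than $$M!\,\Big(\frac1{2\eta}\Big)^{\eta\sqrt N}$$ local minimizers. If $\sigma\le 1$, the same holds with $\eta=3\cdot10^{-3}$, that is, for $M=\lfloor\eta\sqrt N\rfloor\ge1$ with this value of $\eta$. If $\sigma=0$, the same holds for $J_1$ with $\eta=0.109$. -/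

import Mathlib

open scoped Matrix BigOperators ComplexOrder
open MeasureTheory ProbabilityTheory

/-- The index set `⟦-N/2, N/2 - 1⟧` of the signals (`N` even). -/
abbrev Grid (N : ℕ) : Type := ↥(Finset.Ico (-((N : ℤ) / 2)) ((N : ℤ) / 2))

/-- The squared Euclidean norm `‖x‖₂²` of a complex vector. -/
noncomputable def sqNorm {ι : Type*} [Fintype ι] (x : ι → ℂ) : ℝ := ∑ i, ‖x i‖ ^ 2

/-- The normalized Vandermonde matrix `A(Ξ)`, with entries `N^{-1/2} exp(2 i π ξ_m n / N)`. -/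
noncomputable def vandermondeMat (N : ℕ) {M : ℕ} (Ξ : Fin M → ℝ) : Matrix (Grid N) (Fin M) ℂ :=
  Matrix.of fun n m =>
    (1 / (Real.sqrt N : ℂ)) *
      Complex.exp (2 * Complex.I * (Real.pi : ℂ) * ((Ξ m : ℂ) * (((n : ℤ) : ℂ) / (N : ℂ))))

/-! ### The Moore-Penrose pseudo-inverse -/

/-- The four Penrose equations: `X` is the Moore-Penrose pseudo-inverse of `B`. -/
structure IsMoorePenrose {m n : Type*} [Fintype m] [Fintype n]
    (B : Matrix m n ℂ) (X : Matrix n m ℂ) : Prop where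
  mul_mul_self : B * X * B = B
  self_mul_mul : X * B * X = X
  herm_left : (B * X)ᴴ = B * X
  herm_right : (X * B)ᴴ = X * B

theorem IsMoorePenrose.unique {m n : Type*} [Fintype m] [Fintype n]
    {B : Matrix m n ℂ} {X Y : Matrix n m ℂ} (hX : IsMoorePenrose B X) (hY : IsMoorePenrose B Y) :
    X = Y := by
  have h1 : B * X = B * Y := by
    calc B * X = (B * Y * B) * X := by rw [hY.mul_mul_self]
      _ = (B * Y)ᴴ * (B * X)ᴴ := by rw [hX.herm_left, hY.herm_left]; simp only [Matrix.mul_assoc]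
      _ = (B * X * B * Y)ᴴ := by rw [← Matrix.conjTranspose_mul]; simp only [Matrix.mul_assoc]
      _ = B * Y := by rw [hX.mul_mul_self, hY.herm_left]
  have h2 : X * B = Y * B := by
    calc X * B = X * (B * Y * B) := by rw [hY.mul_mul_self]
      _ = (X * B)ᴴ * (Y * B)ᴴ := by rw [hX.herm_right, hY.herm_right]; simp only [Matrix.mul_assoc]
      _ = (Y * (B * X * B))ᴴ := by rw [← Matrix.conjTranspose_mul]; simp only [Matrix.mul_assoc]
      _ = Y * B := by rw [hX.mul_mul_self, hY.herm_right]
  calc X = X * B * X := hX.self_mul_mul.symm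
    _ = Y * (B * X) := by rw [h2, Matrix.mul_assoc]
    _ = Y * B * Y := by rw [h1, Matrix.mul_assoc]
    _ = Y := hY.self_mul_mul

theorem exists_isMoorePenrose {m n : Type*} [Fintype m] [Fintype n] (B : Matrix m n ℂ) :
    ∃ X : Matrix n m ℂ, IsMoorePenrose B X := by
  classical
  have hH : (Bᴴ * B).IsHermitian := Matrix.isHermitian_conjTranspose_mul_self B
  -- a Hermitian `G` that commutes with `H = Bᴴ B`, with `H G H = H` and `G H G = G`
  obtain ⟨G, hG, hGH, hHGH, hGHG⟩ : ∃ G : Matrix n n ℂ, Gᴴ = G ∧ G * (Bᴴ * B) = (Bᴴ * B) * G ∧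
      (Bᴴ * B) * G * (Bᴴ * B) = Bᴴ * B ∧ G * (Bᴴ * B) * G = G := by
    set U : Matrix n n ℂ := (hH.eigenvectorUnitary : Matrix n n ℂ) with hU
    have hUU : Uᴴ * U = 1 := Unitary.coe_star_mul_self hH.eigenvectorUnitary
    set d : n → ℂ := fun i => (hH.eigenvalues i : ℂ) with hd
    have hS : Bᴴ * B = U * Matrix.diagonal d * Uᴴ := by
      have := hH.spectral_theorem
      rw [Unitary.conjStarAlgAut_apply] at this
      exact this
    have key : ∀ e f : n → ℂ, (U * Matrix.diagonal e * Uᴴ) * (U * Matrix.diagonal f * Uᴴ) =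
        U * Matrix.diagonal (fun i => e i * f i) * Uᴴ := by
      intro e f
      calc _ = U * Matrix.diagonal e * (Uᴴ * U) * Matrix.diagonal f * Uᴴ := by
            simp only [Matrix.mul_assoc]
        _ = _ := by
            rw [hUU, Matrix.mul_one, Matrix.mul_assoc U, Matrix.diagonal_mul_diagonal]
    refine ⟨U * Matrix.diagonal (fun i => (d i)⁻¹) * Uᴴ, ?_, ?_, ?_, ?_⟩
    · simp only [Matrix.conjTranspose_mul, Matrix.conjTranspose_conjTranspose,
        Matrix.diagonal_conjTranspose, Matrix.mul_assoc]
      congr 3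
      funext i
      simp [hd]
    · rw [hS, key, key]
      simp only [mul_comm]
    · rw [hS, key, key]
      simp only [mul_inv_mul_cancel]
    · rw [hS, key, key]
      congr 3
      funext i
      by_cases h : d i = 0
      · simp [h]
      · field_simp
  have hz : B * G * (Bᴴ * B) = B := by
    have h0 : (B * G * (Bᴴ * B) - B)ᴴ * (B * G * (Bᴴ * B) - B) = 0 := by
      have e1 : (B * G * (Bᴴ * B) - B)ᴴ = (Bᴴ * B) * G * Bᴴ - Bᴴ := by
        simp only [Matrix.conjTranspose_sub, Matrix.conjTranspose_mul,
          Matrix.conjTranspose_conjTranspose, hG, Matrix.mul_assoc]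
      rw [e1, Matrix.sub_mul, Matrix.mul_sub, Matrix.mul_sub]
      have e2 : Bᴴ * (B * G * (Bᴴ * B)) = Bᴴ * B := by
        rw [← hHGH]; simp only [Matrix.mul_assoc] at hHGH ⊢; simp only [hHGH]
      have e3 : Bᴴ * B * G * Bᴴ * (B * G * (Bᴴ * B)) = Bᴴ * B := by
        rw [Matrix.mul_assoc (Bᴴ * B * G), e2, hHGH]
      have e4 : Bᴴ * B * G * Bᴴ * B = Bᴴ * B := by
        rw [Matrix.mul_assoc (Bᴴ * B * G), hHGH]
      rw [e2, e3, e4]; simp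
    exact sub_eq_zero.mp (Matrix.conjTranspose_mul_self_eq_zero.mp h0)
  refine ⟨G * Bᴴ, ?_, ?_, ?_, ?_⟩
  · rw [← Matrix.mul_assoc, Matrix.mul_assoc (B * G), hz]
  · calc G * Bᴴ * B * (G * Bᴴ) = (G * (Bᴴ * B) * G) * Bᴴ := by simp only [Matrix.mul_assoc]
      _ = G * Bᴴ := by rw [hGHG]
  · simp only [Matrix.conjTranspose_mul, Matrix.conjTranspose_conjTranspose, hG, Matrix.mul_assoc]
  · rw [Matrix.mul_assoc, Matrix.conjTranspose_mul, hG, hGH,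
      Matrix.conjTranspose_mul, Matrix.conjTranspose_conjTranspose]

/-- The Moore-Penrose pseudo-inverse `B⁺` (it exists and is unique by the two lemmas above). -/
noncomputable def pinv {m n : Type*} [Fintype m] [Fintype n] (B : Matrix m n ℂ) : Matrix n m ℂ :=
  Classical.epsilon (IsMoorePenrose B)

theorem pinv_spec {m n : Type*} [Fintype m] [Fintype n] (B : Matrix m n ℂ) :
    IsMoorePenrose B (pinv B) :=
  Classical.epsilon_spec (exists_isMoorePenrose B)

/-! ### Reconstructors -/

/-- The back-projection reconstructor `y ↦ A(Ξ) y`. -/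
noncomputable def backProj (N : ℕ) {M : ℕ} (Ξ : Fin M → ℝ) (y : Fin M → ℂ) : Grid N → ℂ :=
  vandermondeMat N Ξ *ᵥ y

/-- The pseudo-inverse reconstructor `y ↦ (A(Ξ)*)⁺ y`. -/
noncomputable def pinvRec (N : ℕ) {M : ℕ} (Ξ : Fin M → ℝ) (y : Fin M → ℂ) : Grid N → ℂ :=
  pinv (vandermondeMat N Ξ)ᴴ *ᵥ y

/-- The Tikhonov functional `f ↦ ½ ‖B f - y‖² + (lam/2) ‖f‖²`. -/
noncomputable def tikhonovObj {m n : Type*} [Fintype m] [Fintype n] (lam : ℝ)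
    (B : Matrix m n ℂ) (y : m → ℂ) (f : n → ℂ) : ℝ :=
  1 / 2 * sqNorm (B *ᵥ f - y) + lam / 2 * sqNorm f

/-- The minimizer of the Tikhonov functional (for `lam > 0`, see `tikhonovArgmin_eq`). -/
noncomputable def tikhonovArgmin {m n : Type*} [Fintype m] [Fintype n] (lam : ℝ)
    (B : Matrix m n ℂ) (y : m → ℂ) : n → ℂ :=
  Classical.epsilon fun f => ∀ g, tikhonovObj lam B y f ≤ tikhonovObj lam B y g

theorem sqNorm_nonneg {ι : Type*} [Fintype ι] (x : ι → ℂ) : 0 ≤ sqNorm x :=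
  Finset.sum_nonneg fun _ _ => by positivity

theorem sqNorm_eq_zero {ι : Type*} [Fintype ι] {x : ι → ℂ} (h : sqNorm x ≤ 0) : x = 0 := by
  have h0 : ∑ i, ‖x i‖ ^ 2 = 0 := le_antisymm h (sqNorm_nonneg x)
  rw [Finset.sum_eq_zero_iff_of_nonneg (fun _ _ => by positivity)] at h0
  funext i
  simpa using h0 i (Finset.mem_univ i)

theorem sqNorm_add {ι : Type*} [Fintype ι] (x y : ι → ℂ) :
    sqNorm (x + y) = sqNorm x + 2 * (star x ⬝ᵥ y).re + sqNorm y := by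
  have : ∀ i, ‖(x + y) i‖ ^ 2 = ‖x i‖ ^ 2 + 2 * (star (x i) * y i).re + ‖y i‖ ^ 2 := by
    intro i
    simp only [Pi.add_apply, ← Complex.normSq_eq_norm_sq, Complex.normSq_apply]
    simp
    ring
  simp only [sqNorm, this, Finset.sum_add_distrib, ← Finset.mul_sum, dotProduct, Complex.re_sum,
    Pi.star_apply]

/-- For `lam > 0` the Tikhonov functional has a unique minimizer, given by the usual formula. -/
theorem tikhonovArgmin_eq {m n : Type*} [Fintype m] [Fintype n] [DecidableEq n] {lam : ℝ}
    (hlam : 0 < lam) (B : Matrix m n ℂ) (y : m → ℂ) :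
    tikhonovArgmin lam B y =
      ((Bᴴ * B + (lam : ℂ) • (1 : Matrix n n ℂ))⁻¹ * Bᴴ) *ᵥ y := by
  set K : Matrix n n ℂ := Bᴴ * B + (lam : ℂ) • (1 : Matrix n n ℂ) with hK
  have hpd : K.PosDef := by
    refine Matrix.PosDef.posSemidef_add (Matrix.posSemidef_conjTranspose_mul_self B) ?_
    refine Matrix.PosDef.one.smul ?_
    exact_mod_cast hlam
  have hdet : IsUnit K.det := (Matrix.isUnit_iff_isUnit_det K).mp hpd.isUnit
  set f₀ : n → ℂ := (K⁻¹ * Bᴴ) *ᵥ y with hf₀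
  have hKf : K *ᵥ f₀ = Bᴴ *ᵥ y := by
    rw [hf₀, Matrix.mulVec_mulVec, ← Matrix.mul_assoc, Matrix.mul_nonsing_inv _ hdet,
      Matrix.one_mul]
  have hexp : ∀ h : n → ℂ, tikhonovObj lam B y (f₀ + h) =
      tikhonovObj lam B y f₀ + (1 / 2 * sqNorm (B *ᵥ h) + lam / 2 * sqNorm h) := by
    intro h
    have hz : star h ⬝ᵥ (Bᴴ *ᵥ (B *ᵥ f₀ - y)) + (lam : ℂ) * (star h ⬝ᵥ f₀) = 0 := by
      have : Bᴴ *ᵥ (B *ᵥ f₀ - y) + (lam : ℂ) • f₀ = 0 := by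
        rw [Matrix.mulVec_sub, ← hKf, hK, Matrix.add_mulVec, Matrix.mulVec_mulVec,
          Matrix.smul_mulVec, Matrix.one_mulVec]
        abel
      rw [← smul_eq_mul, ← dotProduct_smul, ← dotProduct_add, this, dotProduct_zero]
    have hz' : (star (B *ᵥ h) ⬝ᵥ (B *ᵥ f₀ - y)).re + lam * (star h ⬝ᵥ f₀).re = 0 := by
      have := congrArg Complex.re hz
      rw [Matrix.star_mulVec, ← Matrix.dotProduct_mulVec]
      simpa using this
    have e1 : B *ᵥ (f₀ + h) - y = B *ᵥ h + (B *ᵥ f₀ - y) := by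
      rw [Matrix.mulVec_add]; abel
    rw [tikhonovObj, tikhonovObj, e1, add_comm f₀ h, sqNorm_add, sqNorm_add]
    linear_combination hz'
  have hmin : ∀ g, tikhonovObj lam B y f₀ ≤ tikhonovObj lam B y g := by
    intro g
    have := hexp (g - f₀)
    rw [add_sub_cancel] at this
    rw [this]
    have h1 := sqNorm_nonneg (B *ᵥ (g - f₀))
    have h2 := sqNorm_nonneg (g - f₀)
    have : 0 ≤ 1 / 2 * sqNorm (B *ᵥ (g - f₀)) + lam / 2 * sqNorm (g - f₀) := by positivity
    linarith
  have hs : ∀ g, tikhonovObj lam B y (tikhonovArgmin lam B y) ≤ tikhonovObj lam B y g :=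
    Classical.epsilon_spec (p := fun f => ∀ g, tikhonovObj lam B y f ≤ tikhonovObj lam B y g)
      ⟨f₀, hmin⟩
  have h3 := hs f₀
  have h4 := hexp (tikhonovArgmin lam B y - f₀)
  rw [add_sub_cancel] at h4
  have h1 := sqNorm_nonneg (B *ᵥ (tikhonovArgmin lam B y - f₀))
  refine sub_eq_zero.mp (sqNorm_eq_zero ?_)
  by_contra hpos
  have : 0 < lam / 2 * sqNorm (tikhonovArgmin lam B y - f₀) := by
    have := not_le.mp hpos
    positivity
  linarith

/-- The Tikhonov reconstructor
`y ↦ (1 + lam) argmin_f ½ ‖A(Ξ)* f - y‖² + (lam/2) ‖f‖²`. -/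
noncomputable def tikhonovRec (lam : ℝ) (N : ℕ) {M : ℕ} (Ξ : Fin M → ℝ) (y : Fin M → ℂ) :
    Grid N → ℂ :=
  ((1 + lam : ℝ) : ℂ) • tikhonovArgmin lam (vandermondeMat N Ξ)ᴴ y

/-! ### Noise and cost functions -/

/-- The law of a circularly-symmetric complex Gaussian variable `z` with `E |z|² = σ²`. -/
noncomputable def complexGaussian (σ : ℝ) : Measure ℂ :=
  ((gaussianReal 0 (Real.toNNReal (σ ^ 2 / 2))).prod
    (gaussianReal 0 (Real.toNNReal (σ ^ 2 / 2)))).map fun p : ℝ × ℝ => (⟨p.1, p.2⟩ : ℂ)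

/-- The law `𝒩(0, σ² Id)` of the white Gaussian noise on `ℂ^M`. -/
noncomputable def whiteNoise (σ : ℝ) (M : ℕ) : Measure (Fin M → ℂ) :=
  Measure.pi fun _ => complexGaussian σ

/-- The cost `J(Ξ) = E_w (½ ‖R(A(Ξ)* u + w, Ξ) - u‖²)` of the sampling scheme `Ξ`, for the
signal `u`, the reconstructor `R` and the noise level `σ`. -/
noncomputable def cost {N M : ℕ} (R : (Fin M → ℝ) → (Fin M → ℂ) → Grid N → ℂ) (u : Grid N → ℂ)
    (σ : ℝ) (Ξ : Fin M → ℝ) : ℝ :=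
  ∫ w, 1 / 2 * sqNorm (R Ξ ((vandermondeMat N Ξ)ᴴ *ᵥ u + w) - u) ∂(whiteNoise σ M)

/-- The cost `J₁` of back-projection. -/
noncomputable def J₁ {N : ℕ} (M : ℕ) (u : Grid N → ℂ) (σ : ℝ) : (Fin M → ℝ) → ℝ :=
  cost (backProj N) u σ

/-- The cost `J₂` of the pseudo-inverse method. -/
noncomputable def J₂ {N : ℕ} (M : ℕ) (u : Grid N → ℂ) (σ : ℝ) : (Fin M → ℝ) → ℝ :=
  cost (pinvRec N) u σ

/-- The cost `J₃` of the Tikhonov method with regularization parameter `lam`. -/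
noncomputable def J₃ {N : ℕ} (M : ℕ) (u : Grid N → ℂ) (σ lam : ℝ) : (Fin M → ℝ) → ℝ :=
  cost (tikhonovRec lam N) u σ

/-- The signal with `u[±N/4] = √N / 2` and `u[n] = 0` elsewhere (`N` a multiple of `4`). -/
noncomputable def oscSignal (N : ℕ) : Grid N → ℂ := fun n =>
  if (n : ℤ) = (N : ℤ) / 4 ∨ (n : ℤ) = -((N : ℤ) / 4) then ((Real.sqrt N / 2 : ℝ) : ℂ) else 0

/-- The local minimizers of `J : ℝ^M → ℝ` that lie in the fundamental domain `[-N/2, N/2[^M`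
of the `N`-periodicity. -/
def localMinimizers (N : ℕ) {M : ℕ} (J : (Fin M → ℝ) → ℝ) : Set (Fin M → ℝ) :=
  {Ξ | IsLocalMin J Ξ ∧ ∀ m, Ξ m ∈ Set.Ico (-((N : ℝ) / 2)) ((N : ℝ) / 2)}

/-- The set `S` has more than `x` elements (it may be infinite). -/
def HasMoreThan {α : Type*} (S : Set α) (x : ℝ) : Prop :=
  ∃ T : Finset α, ↑T ⊆ S ∧ x < (T.card : ℝ)

/-!
Let `A = A(Ξ)`, let `E = AᴴA - 1` be the off-diagonal part of the Gram matrix and let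
`y = Aᴴu` be the noiseless data. All three reconstructors have the form `A (1 + t E)⁻¹`, with
`t = 0` for back-projection, `t = 1` for the pseudo-inverse (when `AᴴA` is invertible) and
`t = 1 / (1 + lam)` for Tikhonov.
With `S = (1 + t E)⁻¹` and `F = S (1 + E) S`, integrating out the noise gives

  `2 J(Ξ) = ‖u‖² + Re y* (F - 2 S) y + σ² tr F`.

For the oscillating signal `y_m = cos (π ξ_m / 2)`. If `E` were zero, the cost would be
`-∑ cos² (π ξ_m / 2)` up to constants and factors, with a well at each even integer in each
coordinate. The entries of `E` are values of the Dirichlet kernel, hence at most `1 / (2 D)` when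
the samples are at cyclic distance at least `D`, and the row sums of `E` are at most
`e = (M - 1) / (2 D)`.

Take a cube of half-width `1` around a tuple of well-separated even integers, and minimize `J` on it.
If a coordinate `ξ_m` of the minimizer were on a face, then `y_m = 0`; recentring that coordinate
alone gains `1`, whereas the interactions change by `O(e (1 + σ²))` only, independently of `M`,
because just one row and one column of `E` change (`norm_trace_sub_mul_le`, `reducedCost_lt`).
So the minimizer is interior (`exists_isLocalMin_cost`).

It remains to count cubes. Since `η √N ≥ M`, one has `N ≥ M² / η²`. Split the `N / 2` even integers
of the period into `M` blocks of length about `N / (2 M)`, and use only the first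
`L = ⌊1 / (4 η²)⌋ + 1` of each: this yields `M! L ^ M` cubes with `e ≤ η² / 2`, and
`L ^ M > (1 / (2 η)) ^ (2 M) ≥ (1 / (2 η)) ^ (η √N)` as `η √N < M + 1 ≤ 2 M`.
-/

/-! ### The expected cost of a linear reconstructor -/

instance (σ : ℝ) : IsProbabilityMeasure (complexGaussian σ) :=
  Measure.isProbabilityMeasure_map
    (Complex.measurableEquivRealProd.symm.measurable.aemeasurable)

instance (σ : ℝ) (M : ℕ) : IsProbabilityMeasure (whiteNoise σ M) := by
  unfold whiteNoise; infer_instance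

theorem complexGaussian_map_re (σ : ℝ) :
    (complexGaussian σ).map Complex.re = gaussianReal 0 (Real.toNNReal (σ ^ 2 / 2)) := by
  have hm : Measurable fun p : ℝ × ℝ => (⟨p.1, p.2⟩ : ℂ) :=
    Complex.measurableEquivRealProd.symm.measurable
  rw [complexGaussian, Measure.map_map Complex.measurable_re hm]
  exact (measurePreserving_fst).map_eq

theorem complexGaussian_map_im (σ : ℝ) :
    (complexGaussian σ).map Complex.im = gaussianReal 0 (Real.toNNReal (σ ^ 2 / 2)) := by
  have hm : Measurable fun p : ℝ × ℝ => (⟨p.1, p.2⟩ : ℂ) :=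
    Complex.measurableEquivRealProd.symm.measurable
  rw [complexGaussian, Measure.map_map Complex.measurable_im hm]
  exact (measurePreserving_snd).map_eq

theorem integral_sq_gaussianReal (v : NNReal) : ∫ x, x ^ 2 ∂(gaussianReal 0 v) = v := by
  have h := variance_id_gaussianReal (μ := 0) (v := v)
  rw [variance_of_integral_eq_zero (by fun_prop) (by simp)] at h
  simpa using h

theorem memLp_re_complexGaussian (σ : ℝ) : MemLp Complex.re 2 (complexGaussian σ) := by
  have h := memLp_id_gaussianReal (μ := 0) (v := Real.toNNReal (σ ^ 2 / 2)) 2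
  rw [← complexGaussian_map_re, memLp_map_measure_iff (by fun_prop) (by fun_prop)] at h
  simpa using h

theorem memLp_im_complexGaussian (σ : ℝ) : MemLp Complex.im 2 (complexGaussian σ) := by
  have h := memLp_id_gaussianReal (μ := 0) (v := Real.toNNReal (σ ^ 2 / 2)) 2
  rw [← complexGaussian_map_im, memLp_map_measure_iff (by fun_prop) (by fun_prop)] at h
  simpa using h

theorem memLp_id_complexGaussian (σ : ℝ) : MemLp (fun z : ℂ => z) 2 (complexGaussian σ) := by
  have h := (memLp_re_complexGaussian σ).ofReal (K := ℂ)
  have h' := ((memLp_im_complexGaussian σ).ofReal (K := ℂ)).mul_const Complex.I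
  refine (h.add h').congr_norm (by fun_prop) (ae_of_all _ fun z => ?_)
  simp [Complex.re_add_im]

theorem integral_id_complexGaussian (σ : ℝ) : ∫ z, z ∂(complexGaussian σ) = 0 := by
  have hi : Integrable (fun z : ℂ => z) (complexGaussian σ) :=
    (memLp_id_complexGaussian σ).integrable (by norm_num)
  apply Complex.ext
  · have h := Complex.reCLM.integral_comp_comm hi
    have h2 := integral_map (μ := complexGaussian σ) (φ := Complex.re) (f := fun x : ℝ => x)
      (by fun_prop) (by fun_prop)
    rw [complexGaussian_map_re, integral_id_gaussianReal] at h2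
    simpa [← h2] using h.symm
  · have h := Complex.imCLM.integral_comp_comm hi
    have h2 := integral_map (μ := complexGaussian σ) (φ := Complex.im) (f := fun x : ℝ => x)
      (by fun_prop) (by fun_prop)
    rw [complexGaussian_map_im, integral_id_gaussianReal] at h2
    simpa [← h2] using h.symm

theorem integral_norm_sq_complexGaussian (σ : ℝ) :
    ∫ z, ‖z‖ ^ 2 ∂(complexGaussian σ) = σ ^ 2 := by
  have h : ∀ z : ℂ, ‖z‖ ^ 2 = z.re ^ 2 + z.im ^ 2 := fun z => by
    rw [← Complex.normSq_eq_norm_sq, Complex.normSq_apply]; ring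
  simp only [h]
  rw [integral_add (memLp_re_complexGaussian σ).integrable_sq
    (memLp_im_complexGaussian σ).integrable_sq]
  have h1 := integral_map (μ := complexGaussian σ) (φ := Complex.re) (f := fun x : ℝ => x ^ 2)
    (by fun_prop) (by fun_prop)
  have h2 := integral_map (μ := complexGaussian σ) (φ := Complex.im) (f := fun x : ℝ => x ^ 2)
    (by fun_prop) (by fun_prop)
  rw [complexGaussian_map_re, integral_sq_gaussianReal] at h1
  rw [complexGaussian_map_im, integral_sq_gaussianReal] at h2
  rw [← h1, ← h2, Real.coe_toNNReal _ (by positivity)]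
  ring

theorem measurePreserving_eval_whiteNoise (σ : ℝ) {M : ℕ} (m : Fin M) :
    MeasurePreserving (fun w : Fin M → ℂ => w m) (whiteNoise σ M) (complexGaussian σ) :=
  measurePreserving_eval (fun _ : Fin M => complexGaussian σ) m

theorem memLp_eval_whiteNoise (σ : ℝ) {M : ℕ} (m : Fin M) :
    MemLp (fun w : Fin M → ℂ => w m) 2 (whiteNoise σ M) :=
  (memLp_id_complexGaussian σ).comp_measurePreserving (measurePreserving_eval_whiteNoise σ m)

theorem integral_eval_whiteNoise (σ : ℝ) {M : ℕ} (m : Fin M) :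
    ∫ w, w m ∂(whiteNoise σ M) = 0 := by
  have h := integral_map (μ := whiteNoise σ M) (φ := fun w : Fin M → ℂ => w m)
    (f := fun z : ℂ => z) (measurable_pi_apply m).aemeasurable (by fun_prop)
  rw [(measurePreserving_eval_whiteNoise σ m).map_eq, integral_id_complexGaussian] at h
  exact h.symm

theorem integrable_eval_mul_star_whiteNoise (σ : ℝ) {M : ℕ} (i j : Fin M) :
    Integrable (fun w : Fin M → ℂ => w i * star (w j)) (whiteNoise σ M) :=
  (memLp_eval_whiteNoise σ i).integrable_mul (memLp_eval_whiteNoise σ j).star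

/-- The covariance of the white noise is `σ² Id`. -/
theorem integral_eval_mul_star_whiteNoise (σ : ℝ) {M : ℕ} (i j : Fin M) :
    ∫ w, w i * star (w j) ∂(whiteNoise σ M) = if i = j then ((σ ^ 2 : ℝ) : ℂ) else 0 := by
  split_ifs with h
  · subst h
    have h1 : ∀ w : Fin M → ℂ, w i * star (w i) = ((‖w i‖ ^ 2 : ℝ) : ℂ) := fun w => by
      rw [Complex.star_def, Complex.mul_conj, Complex.normSq_eq_norm_sq]
    simp only [h1]
    rw [integral_complex_ofReal]
    have h := integral_map (μ := whiteNoise σ M) (φ := fun w : Fin M → ℂ => w i)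
      (f := fun z : ℂ => ‖z‖ ^ 2) (measurable_pi_apply i).aemeasurable (by fun_prop)
    rw [(measurePreserving_eval_whiteNoise σ i).map_eq, integral_norm_sq_complexGaussian] at h
    rw [h]
  · have hind : iIndepFun (fun (m : Fin M) (w : Fin M → ℂ) => w m) (whiteNoise σ M) :=
      iIndepFun_pi (X := fun _ : Fin M => (id : ℂ → ℂ)) (fun _ => by fun_prop)
    have h2 := (hind.indepFun h).comp (φ := fun z : ℂ => z) (ψ := fun z : ℂ => star z)
      measurable_id (by fun_prop)
    have h3 := h2.integral_mul_eq_mul_integral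
      (memLp_eval_whiteNoise σ i).aestronglyMeasurable
      (memLp_eval_whiteNoise σ j).star.aestronglyMeasurable
    have h4 : ∫ w, w i * star (w j) ∂(whiteNoise σ M) =
      (∫ w, w i ∂(whiteNoise σ M)) * ∫ w, star (w j) ∂(whiteNoise σ M) := h3
    rw [h4, integral_eval_whiteNoise, zero_mul]

theorem integral_const_add_linear_add {Ω : Type*} [MeasurableSpace Ω] {μ : Measure Ω}
    [IsProbabilityMeasure μ] {X Y Q : Ω → ℂ} (hX : Integrable X μ) (hY : Integrable Y μ)
    (hQ : Integrable Q μ) (c d e : ℂ) :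
    ∫ w, (c + (d * X w + e * Y w)) + Q w ∂μ =
      (c + (d * ∫ w, X w ∂μ + e * ∫ w, Y w ∂μ)) + ∫ w, Q w ∂μ := by
  have h1 : Integrable (fun w => d * X w + e * Y w) μ := (hX.const_mul d).add (hY.const_mul e)
  have h2 : Integrable (fun w => c + (d * X w + e * Y w)) μ := (integrable_const c).add h1
  rw [integral_add h2 hQ, integral_add (integrable_const c) h1,
    integral_add (hX.const_mul d) (hY.const_mul e), integral_const_mul, integral_const_mul]
  simp

/-- The mean square of an affine form of the noise. -/
theorem integral_norm_sq_affine_whiteNoise (σ : ℝ) {M : ℕ} (c : ℂ) (a : Fin M → ℂ) :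
    Integrable (fun w : Fin M → ℂ => ‖c + ∑ m, a m * w m‖ ^ 2) (whiteNoise σ M) ∧
    ∫ w, ‖c + ∑ m, a m * w m‖ ^ 2 ∂(whiteNoise σ M) = ‖c‖ ^ 2 + σ ^ 2 * ∑ m, ‖a m‖ ^ 2 := by
  have hlin : MemLp (fun w : Fin M → ℂ => ∑ m, a m * w m) 2 (whiteNoise σ M) :=
    memLp_finsetSum _ fun m _ => (memLp_eval_whiteNoise σ m).const_mul (a m)
  have hlin1 := hlin.integrable (by norm_num)
  have hlin0 : ∫ w, ∑ m, a m * w m ∂(whiteNoise σ M) = 0 := by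
    rw [integral_finsetSum _ fun m _ =>
      ((memLp_eval_whiteNoise σ m).integrable (by norm_num)).const_mul (a m)]
    simp [integral_const_mul, integral_eval_whiteNoise]
  refine ⟨((memLp_const c).add hlin).integrable_norm_pow (by norm_num), ?_⟩
  have hexp : ∀ w : Fin M → ℂ, ((‖c + ∑ m, a m * w m‖ ^ 2 : ℝ) : ℂ) =
      (c * star c + (star c * (∑ m, a m * w m) + c * star (∑ m, a m * w m))) +
        ∑ i, ∑ j, a i * star (a j) * (w i * star (w j)) := by
    intro w
    have hs : ∑ i, ∑ j, a i * star (a j) * (w i * star (w j)) =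
        (∑ m, a m * w m) * star (∑ m, a m * w m) := by
      rw [star_sum, Finset.sum_mul_sum]
      refine Finset.sum_congr rfl fun i _ => Finset.sum_congr rfl fun j _ => ?_
      rw [star_mul']; ring
    rw [hs, ← Complex.normSq_eq_norm_sq, ← Complex.mul_conj, ← Complex.star_def, star_add]
    ring
  have hint : ∀ i j, Integrable (fun w : Fin M → ℂ => a i * star (a j) * (w i * star (w j)))
      (whiteNoise σ M) := fun i j => (integrable_eval_mul_star_whiteNoise σ i j).const_mul _
  have hstar : Integrable (fun w : Fin M → ℂ => star (∑ m, a m * w m)) (whiteNoise σ M) :=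
    (hlin.star).integrable (by norm_num)
  have hstar0 : ∫ w, star (∑ m, a m * w m) ∂(whiteNoise σ M) = 0 := by
    have := integral_conj (μ := whiteNoise σ M) (f := fun w : Fin M → ℂ => ∑ m, a m * w m)
    rw [hlin0] at this
    simpa using this
  apply Complex.ofReal_injective
  rw [← integral_complex_ofReal]
  simp only [hexp]
  have hquad : Integrable (fun w : Fin M → ℂ =>
      ∑ i, ∑ j, a i * star (a j) * (w i * star (w j))) (whiteNoise σ M) :=
    integrable_finsetSum _ fun i _ => integrable_finsetSum _ fun j _ => hint i j
  rw [integral_const_add_linear_add hlin1 hstar hquad, hlin0, hstar0,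
    integral_finsetSum _ fun i _ => integrable_finsetSum _ fun j _ => hint i j]
  have hij : ∀ i, ∫ w, ∑ j, a i * star (a j) * (w i * star (w j)) ∂(whiteNoise σ M) =
      ((σ ^ 2 * ‖a i‖ ^ 2 : ℝ) : ℂ) := by
    intro i
    rw [integral_finsetSum _ fun j _ => hint i j]
    simp only [integral_const_mul, integral_eval_mul_star_whiteNoise, mul_ite, mul_zero,
      Finset.sum_ite_eq, Finset.mem_univ, if_true]
    rw [Complex.star_def, Complex.mul_conj, Complex.normSq_eq_norm_sq]
    push_cast; ring
  simp only [hij]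
  rw [Complex.star_def, Complex.mul_conj, Complex.normSq_eq_norm_sq]
  simp [Finset.mul_sum]

/-- For a linear reconstructor with matrix `T`, the noise adds `σ² ‖T‖_F²` to the squared error. -/
theorem integral_sqNorm_linear (σ : ℝ) {ι : Type*} [Fintype ι] {M : ℕ}
    (T : Matrix ι (Fin M) ℂ) (v : Fin M → ℂ) (u : ι → ℂ) :
    ∫ w, 1 / 2 * sqNorm (T *ᵥ (v + w) - u) ∂(whiteNoise σ M) =
      1 / 2 * sqNorm (T *ᵥ v - u) + 1 / 2 * (σ ^ 2 * (Tᴴ * T).trace.re) := by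
  have h : ∀ w : Fin M → ℂ, sqNorm (T *ᵥ (v + w) - u) =
      ∑ n, ‖(T *ᵥ v - u) n + ∑ m, T n m * w m‖ ^ 2 := by
    intro w
    refine Finset.sum_congr rfl fun n _ => ?_
    rw [Matrix.mulVec_add]
    congr 2
    simp only [Pi.sub_apply, Pi.add_apply, Matrix.mulVec, dotProduct]
    ring
  have htr : (Tᴴ * T).trace.re = ∑ n, ∑ m, ‖T n m‖ ^ 2 := by
    rw [Finset.sum_comm, Matrix.trace, Complex.re_sum]
    refine Finset.sum_congr rfl fun m _ => ?_
    rw [Matrix.diag_apply, Matrix.mul_apply, Complex.re_sum]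
    refine Finset.sum_congr rfl fun n _ => ?_
    rw [Matrix.conjTranspose_apply, Complex.star_def, mul_comm, Complex.mul_conj,
      Complex.normSq_eq_norm_sq, Complex.ofReal_re]
  have hn := fun n => integral_norm_sq_affine_whiteNoise σ ((T *ᵥ v - u) n) fun m => T n m
  simp only [h]
  rw [integral_const_mul, integral_finsetSum _ fun n _ => (hn n).1]
  simp only [fun n => (hn n).2]
  rw [Finset.sum_add_distrib, ← Finset.mul_sum, htr, sqNorm]
  ring

/-! ### The three reconstructors as one family of linear maps -/

/-- The off-diagonal part `E = A(Ξ)ᴴ A(Ξ) - 1` of the Gram matrix of the sampled exponentials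
(the diagonal of the Gram matrix is `1`). -/
noncomputable def offGram (N : ℕ) {M : ℕ} (Ξ : Fin M → ℝ) : Matrix (Fin M) (Fin M) ℂ :=
  (vandermondeMat N Ξ)ᴴ * vandermondeMat N Ξ - 1

/-- The matrix `(1 + t E)⁻¹`; it filters the data before back-projection. The values `t = 0`,
`t = 1` and `t = 1 / (1 + lam)` correspond to the three reconstructors. -/
noncomputable def dataFilter {ι : Type*} [Fintype ι] [DecidableEq ι] (t : ℝ) (E : Matrix ι ι ℂ) :
    Matrix ι ι ℂ :=
  (1 + (t : ℂ) • E)⁻¹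

/-- The matrix `S (1 + E) S` with `S = (1 + t E)⁻¹`: the Gram matrix of the columns of the
reconstruction matrix `A S`. -/
noncomputable def filteredGram {ι : Type*} [Fintype ι] [DecidableEq ι] (t : ℝ)
    (E : Matrix ι ι ℂ) : Matrix ι ι ℂ :=
  dataFilter t E * (1 + E) * dataFilter t E

/-- Twice the cost, up to the constant `‖u‖²`, of the reconstructor `A (1 + t E)⁻¹`, for noiseless
data `y`: a quadratic form in `y` plus the contribution of the noise. -/
noncomputable def reducedCost {ι : Type*} [Fintype ι] [DecidableEq ι] (t σ : ℝ)
    (E : Matrix ι ι ℂ) (y : ι → ℂ) : ℝ :=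
  (star y ⬝ᵥ ((filteredGram t E - (2 : ℂ) • dataFilter t E) *ᵥ y)).re +
    σ ^ 2 * (filteredGram t E).trace.re

theorem offGram_conjTranspose (N : ℕ) {M : ℕ} (Ξ : Fin M → ℝ) :
    (offGram N Ξ)ᴴ = offGram N Ξ := by
  simp [offGram, Matrix.conjTranspose_mul]

section
variable {ι : Type*} [Fintype ι] [DecidableEq ι]

theorem dataFilter_conjTranspose (t : ℝ) {E : Matrix ι ι ℂ} (hE : Eᴴ = E) :
    (dataFilter t E)ᴴ = dataFilter t E := by
  simp [dataFilter, Matrix.conjTranspose_nonsing_inv, hE]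

theorem dataFilter_mul_self {t : ℝ} {E : Matrix ι ι ℂ} (h : IsUnit (1 + (t : ℂ) • E)) :
    dataFilter t E * (1 + (t : ℂ) • E) = 1 :=
  Matrix.nonsing_inv_mul _ ((Matrix.isUnit_iff_isUnit_det _).mp h)

theorem self_mul_dataFilter {t : ℝ} {E : Matrix ι ι ℂ} (h : IsUnit (1 + (t : ℂ) • E)) :
    (1 + (t : ℂ) • E) * dataFilter t E = 1 :=
  Matrix.mul_nonsing_inv _ ((Matrix.isUnit_iff_isUnit_det _).mp h)

end

/-- The cost of the reconstructor `A (1 + t E)⁻¹`. -/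
theorem cost_eq_reducedCost {N M : ℕ} {R : (Fin M → ℝ) → (Fin M → ℂ) → Grid N → ℂ}
    {Ξ : Fin M → ℝ} {t : ℝ}
    (hR : ∀ y, R Ξ y = (vandermondeMat N Ξ * dataFilter t (offGram N Ξ)) *ᵥ y)
    (u : Grid N → ℂ) (σ : ℝ) :
    cost R u σ Ξ = 1 / 2 * sqNorm u +
      1 / 2 * reducedCost t σ (offGram N Ξ) ((vandermondeMat N Ξ)ᴴ *ᵥ u) := by
  set A := vandermondeMat N Ξ with hA
  set y := Aᴴ *ᵥ u with hy
  set S := dataFilter t (offGram N Ξ) with hS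
  have hSH : Sᴴ = S := dataFilter_conjTranspose t (offGram_conjTranspose N Ξ)
  have hG : Aᴴ * A = 1 + offGram N Ξ := by rw [offGram]; abel
  have hTT : (A * S)ᴴ * (A * S) = filteredGram t (offGram N Ξ) := by
    rw [Matrix.conjTranspose_mul, hSH, filteredGram, ← hS, ← hG]
    simp only [Matrix.mul_assoc]
  have hcost : cost R u σ Ξ =
      ∫ w, 1 / 2 * sqNorm ((A * S) *ᵥ (y + w) - u) ∂(whiteNoise σ M) := by
    simp only [cost, hR, ← hA, ← hy]
  rw [hcost, integral_sqNorm_linear, hTT, reducedCost, ← hS, sub_eq_add_neg, sqNorm_add]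
  have h1 : sqNorm ((A * S) *ᵥ y) = (star y ⬝ᵥ (filteredGram t (offGram N Ξ) *ᵥ y)).re := by
    have h0 : ∀ x : Grid N → ℂ, sqNorm x = (star x ⬝ᵥ x).re := by
      intro x
      simp only [sqNorm, dotProduct, Complex.re_sum, Pi.star_apply]
      refine Finset.sum_congr rfl fun i _ => ?_
      rw [Complex.star_def, mul_comm, Complex.mul_conj, Complex.normSq_eq_norm_sq,
        Complex.ofReal_re]
    rw [h0, Matrix.star_mulVec, ← Matrix.dotProduct_mulVec, Matrix.mulVec_mulVec, hTT]
  have h2 : star ((A * S) *ᵥ y) ⬝ᵥ (-u) = -(star y ⬝ᵥ (S *ᵥ y)) := by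
    rw [Matrix.star_mulVec, ← Matrix.dotProduct_mulVec, Matrix.conjTranspose_mul, hSH,
      Matrix.mulVec_neg, dotProduct_neg, ← Matrix.mulVec_mulVec, ← hy]
  have h3 : sqNorm (-u) = sqNorm u := by simp [sqNorm]
  have h4 : (star y ⬝ᵥ ((2 : ℂ) • (S *ᵥ y))).re = 2 * (star y ⬝ᵥ (S *ᵥ y)).re := by
    rw [dotProduct_smul]; simp
  rw [h1, h2, h3, Matrix.sub_mulVec, Matrix.smul_mulVec, dotProduct_sub, Complex.sub_re, h4,
    Complex.neg_re]
  ring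

theorem backProj_eq_filtered (N : ℕ) {M : ℕ} (Ξ : Fin M → ℝ) (y : Fin M → ℂ) :
    backProj N Ξ y = (vandermondeMat N Ξ * dataFilter 0 (offGram N Ξ)) *ᵥ y := by
  simp [backProj, dataFilter]

/-- When the Gram matrix `G = AᴴA` is invertible, `(Aᴴ)⁺ = A G⁻¹`. -/
theorem pinvRec_eq_filtered (N : ℕ) {M : ℕ} (Ξ : Fin M → ℝ) (y : Fin M → ℂ)
    (h : IsUnit (1 + ((1 : ℝ) : ℂ) • offGram N Ξ)) :
    pinvRec N Ξ y = (vandermondeMat N Ξ * dataFilter 1 (offGram N Ξ)) *ᵥ y := by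
  have hS := dataFilter_mul_self h
  have hS' := self_mul_dataFilter h
  have hSH := dataFilter_conjTranspose 1 (offGram_conjTranspose N Ξ)
  set A := vandermondeMat N Ξ with hA
  set S := dataFilter 1 (offGram N Ξ)
  have hG : 1 + ((1 : ℝ) : ℂ) • offGram N Ξ = Aᴴ * A := by
    rw [offGram, Complex.ofReal_one, one_smul]; abel
  rw [hG] at hS hS'
  have key : Aᴴ * (A * S) = 1 := by rw [← Matrix.mul_assoc, hS']
  have hMP : IsMoorePenrose Aᴴ (A * S) := by
    refine ⟨?_, ?_, ?_, ?_⟩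
    · rw [key, Matrix.one_mul]
    · rw [Matrix.mul_assoc, key, Matrix.mul_one]
    · rw [key, Matrix.conjTranspose_one]
    · simp only [Matrix.conjTranspose_mul, Matrix.conjTranspose_conjTranspose, hSH,
        Matrix.mul_assoc]
  rw [pinvRec, ← hA, (pinv_spec Aᴴ).unique hMP]

/-- The push-through identity `(A Aᴴ + lam)⁻¹ A = A (AᴴA + lam)⁻¹` puts the Tikhonov reconstructor
into filtered form. -/
theorem tikhonovRec_eq_filtered {lam : ℝ} (hlam : 0 < lam) (N : ℕ) {M : ℕ} (Ξ : Fin M → ℝ)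
    (y : Fin M → ℂ) (h : IsUnit (1 + ((1 / (1 + lam) : ℝ) : ℂ) • offGram N Ξ)) :
    tikhonovRec lam N Ξ y =
      (vandermondeMat N Ξ * dataFilter (1 / (1 + lam)) (offGram N Ξ)) *ᵥ y := by
  have hS' := self_mul_dataFilter h
  rw [tikhonovRec, tikhonovArgmin_eq hlam, Matrix.conjTranspose_conjTranspose,
    ← Matrix.smul_mulVec]
  set A := vandermondeMat N Ξ with hA
  set S := dataFilter (1 / (1 + lam)) (offGram N Ξ)
  set K := A * Aᴴ + (lam : ℂ) • (1 : Matrix (Grid N) (Grid N) ℂ) with hK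
  have hpd : K.PosDef := by
    refine Matrix.PosDef.posSemidef_add (Matrix.posSemidef_self_mul_conjTranspose A) ?_
    exact Matrix.PosDef.one.smul (by exact_mod_cast hlam)
  have hdet : IsUnit K.det := (Matrix.isUnit_iff_isUnit_det K).mp hpd.isUnit
  have hG : Aᴴ * A + (lam : ℂ) • (1 : Matrix (Fin M) (Fin M) ℂ) =
      ((1 + lam : ℝ) : ℂ) • (1 + ((1 / (1 + lam) : ℝ) : ℂ) • offGram N Ξ) := by
    rw [smul_add, smul_smul, ← Complex.ofReal_mul, mul_one_div_cancel (by positivity),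
      Complex.ofReal_one, one_smul, offGram, ← hA, Complex.ofReal_add, add_smul,
      Complex.ofReal_one, one_smul]
    abel
  have hKA : K * (A * S) = ((1 + lam : ℝ) : ℂ) • A := by
    have : K * A = A * (Aᴴ * A + (lam : ℂ) • (1 : Matrix (Fin M) (Fin M) ℂ)) := by
      rw [hK, Matrix.add_mul, Matrix.mul_add, Matrix.mul_assoc]; simp
    rw [← Matrix.mul_assoc, this, hG, Matrix.mul_smul, Matrix.smul_mul, Matrix.mul_assoc, hS',
      Matrix.mul_one]
  congr 1
  rw [← Matrix.mul_smul, ← hKA, ← Matrix.mul_assoc, Matrix.nonsing_inv_mul _ hdet, Matrix.one_mul]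

/-! ### Perturbation of one sample -/

section perturbation

attribute [local instance] Matrix.linftyOpNormedAddCommGroup Matrix.linftyOpNormedRing
  Matrix.linftyOpNormedAlgebra

variable {ι : Type*} [Fintype ι] [DecidableEq ι]

theorem sum_row_norm_le (A : Matrix ι ι ℂ) (i : ι) : ∑ j, ‖A i j‖ ≤ ‖A‖ := by
  rw [Matrix.linfty_opNorm_def]
  have h := NNReal.coe_le_coe.2
    (Finset.le_sup (f := fun i => ∑ j, ‖A i j‖₊) (Finset.mem_univ i))
  simpa only [NNReal.coe_sum, coe_nnnorm] using h

theorem linfty_opNorm_le {A : Matrix ι ι ℂ} {c : ℝ} (hc : 0 ≤ c)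
    (h : ∀ i, ∑ j, ‖A i j‖ ≤ c) : ‖A‖ ≤ c := by
  rw [Matrix.linfty_opNorm_def]
  lift c to NNReal using hc
  have : (Finset.univ.sup fun i => ∑ j, ‖A i j‖₊) ≤ c := by
    refine Finset.sup_le fun i _ => NNReal.coe_le_coe.1 ?_
    simpa only [NNReal.coe_sum, coe_nnnorm] using h i
  exact_mod_cast this

theorem linfty_opNorm_one_le : ‖(1 : Matrix ι ι ℂ)‖ ≤ 1 := by
  refine linfty_opNorm_le zero_le_one fun i => ?_
  simp [Matrix.one_apply, apply_ite]

theorem norm_mul_apply_le (A B : Matrix ι ι ℂ) {w : ℝ} (hB : ∀ i j, ‖B i j‖ ≤ w) (i j : ι) :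
    ‖(A * B) i j‖ ≤ ‖A‖ * w := by
  have hw : 0 ≤ w := (norm_nonneg _).trans (hB i j)
  rw [Matrix.mul_apply]
  calc ‖∑ k, A i k * B k j‖ ≤ ∑ k, ‖A i k‖ * w := by
        refine (norm_sum_le _ _).trans (Finset.sum_le_sum fun k _ => ?_)
        rw [norm_mul]
        exact mul_le_mul_of_nonneg_left (hB k j) (norm_nonneg _)
    _ ≤ ‖A‖ * w := by
        rw [← Finset.sum_mul]
        exact mul_le_mul_of_nonneg_right (sum_row_norm_le A i) hw

theorem norm_mul_mul_apply_le (Y W X : Matrix ι ι ℂ) {w : ℝ} (hW : ∀ i j, ‖W i j‖ ≤ w)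
    (i j : ι) : ‖(Y * W * X) i j‖ ≤ ‖Y‖ * w * ‖Xᴴ‖ := by
  rw [← norm_star, ← Matrix.conjTranspose_apply, Matrix.conjTranspose_mul, mul_comm]
  refine norm_mul_apply_le _ _ (fun a b => ?_) _ _
  rw [Matrix.conjTranspose_apply, norm_star]
  exact norm_mul_apply_le _ _ hW _ _

/-- A trace against a sparse matrix `D` is controlled by the entries of `D` alone, uniformly in the
dimension. -/
theorem norm_trace_sandwich_le (X D Y W : Matrix ι ι ℂ) {w : ℝ} (hW : ∀ i j, ‖W i j‖ ≤ w) :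
    ‖(X * D * Y * W).trace‖ ≤ (∑ i, ∑ j, ‖D i j‖) * (‖Y‖ * w * ‖Xᴴ‖) := by
  have h : (X * D * Y * W).trace = (D * (Y * W * X)).trace := by
    rw [Matrix.mul_assoc, Matrix.mul_assoc, Matrix.trace_mul_comm, Matrix.mul_assoc]
  rw [h, Matrix.trace, Finset.sum_mul]
  refine (norm_sum_le _ _).trans (Finset.sum_le_sum fun i _ => ?_)
  rw [Matrix.diag_apply, Matrix.mul_apply, Finset.sum_mul]
  refine (norm_sum_le _ _).trans (Finset.sum_le_sum fun j _ => ?_)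
  rw [norm_mul]
  exact mul_le_mul_of_nonneg_left (norm_mul_mul_apply_le Y W X hW j i) (norm_nonneg _)

theorem sum_norm_le_of_eq_off {D : Matrix ι ι ℂ} (hD : Dᴴ = D) (m : ι)
    (h : ∀ i j, i ≠ m → j ≠ m → D i j = 0) : ∑ i, ∑ j, ‖D i j‖ ≤ 2 * ‖D‖ := by
  have hsym : ∀ i, ‖D i m‖ = ‖D m i‖ := fun i => by
    conv_lhs => rw [← hD, Matrix.conjTranspose_apply, norm_star]
  have hrow : ∀ i ∈ Finset.univ.erase m, ∑ j, ‖D i j‖ = ‖D m i‖ := by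
    intro i hi
    rw [Finset.sum_eq_single m, hsym]
    · intro j _ hj
      rw [h i j (Finset.ne_of_mem_erase hi) hj, norm_zero]
    · simp
  rw [← Finset.add_sum_erase _ _ (Finset.mem_univ m), Finset.sum_congr rfl hrow]
  have h1 := sum_row_norm_le D m
  have h2 : ∑ i ∈ Finset.univ.erase m, ‖D m i‖ ≤ ∑ i, ‖D m i‖ :=
    Finset.sum_le_sum_of_subset_of_nonneg (Finset.erase_subset _ _) fun _ _ _ => norm_nonneg _
  linarith

theorem norm_smul_le_of_le_one {t : ℝ} (ht0 : 0 ≤ t) (ht1 : t ≤ 1) (E : Matrix ι ι ℂ) :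
    ‖(t : ℂ) • E‖ ≤ ‖E‖ := by
  rw [norm_smul, Complex.norm_real, Real.norm_of_nonneg ht0]
  exact mul_le_of_le_one_left (norm_nonneg _) ht1

theorem isUnit_one_add_smul {t : ℝ} (ht0 : 0 ≤ t) (ht1 : t ≤ 1) {E : Matrix ι ι ℂ}
    (hE : ‖E‖ < 1) : IsUnit (1 + (t : ℂ) • E) := by
  have h := isUnit_one_sub_of_norm_lt_one (x := -((t : ℂ) • E))
    (by rw [norm_neg]; exact (norm_smul_le_of_le_one ht0 ht1 E).trans_lt hE)
  rwa [sub_neg_eq_add] at h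

theorem norm_dataFilter_le {t : ℝ} (ht0 : 0 ≤ t) (ht1 : t ≤ 1) {E : Matrix ι ι ℂ}
    (hE : ‖E‖ ≤ 1 / 2) : ‖dataFilter t E‖ ≤ 2 := by
  have h := dataFilter_mul_self (isUnit_one_add_smul ht0 ht1 (hE.trans_lt (by norm_num)))
  have h1 : dataFilter t E = 1 - dataFilter t E * ((t : ℂ) • E) := by
    rw [mul_add, mul_one] at h
    exact eq_sub_of_add_eq h
  have h2 : ‖dataFilter t E‖ ≤ 1 + ‖dataFilter t E‖ * (1 / 2) := by
    conv_lhs => rw [h1]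
    refine (norm_sub_le _ _).trans (add_le_add linfty_opNorm_one_le ?_)
    refine (norm_mul_le _ _).trans (mul_le_mul_of_nonneg_left ?_ (norm_nonneg _))
    exact (norm_smul_le_of_le_one ht0 ht1 E).trans hE
  linarith

/-- The second resolvent identity. -/
theorem dataFilter_sub_dataFilter {t : ℝ} {E E' : Matrix ι ι ℂ} (h : IsUnit (1 + (t : ℂ) • E))
    (h' : IsUnit (1 + (t : ℂ) • E')) :
    dataFilter t E - dataFilter t E' =
      -((t : ℂ) • (dataFilter t E * (E - E') * dataFilter t E')) := by
  have h1 := dataFilter_mul_self h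
  have h2 := self_mul_dataFilter h'
  calc dataFilter t E - dataFilter t E'
      = dataFilter t E * ((1 + (t : ℂ) • E') * dataFilter t E') -
        (dataFilter t E * (1 + (t : ℂ) • E)) * dataFilter t E' := by
          rw [h1, h2, mul_one, one_mul]
    _ = _ := by
      simp only [mul_add, add_mul, mul_sub, sub_mul, mul_one, one_mul, Matrix.mul_smul,
        Matrix.smul_mul, smul_sub, Matrix.mul_assoc]
      abel

/-- Up to `‖E‖`, the quadratic form in the reduced cost is minus the identity. -/
theorem norm_filteredGram_sub_dataFilter_add_one_le {t e : ℝ} (ht0 : 0 ≤ t) (ht1 : t ≤ 1)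
    {E : Matrix ι ι ℂ} (he : ‖E‖ ≤ e) (he2 : e ≤ 1 / 2) :
    ‖filteredGram t E - (2 : ℂ) • dataFilter t E + 1‖ ≤ 4 * e + 4 * e ^ 2 := by
  have hS := norm_dataFilter_le ht0 ht1 (he.trans he2)
  have h := dataFilter_mul_self (isUnit_one_add_smul ht0 ht1
    ((he.trans he2).trans_lt (by norm_num)))
  set S := dataFilter t E
  have h1 : S - 1 = -(S * ((t : ℂ) • E)) := by
    rw [mul_add, mul_one] at h
    rw [← h]; abel
  have h2 : ‖S - 1‖ ≤ 2 * e := by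
    rw [h1, norm_neg]
    refine (norm_mul_le _ _).trans (mul_le_mul hS ?_ (norm_nonneg _) (by norm_num))
    exact (norm_smul_le_of_le_one ht0 ht1 E).trans he
  have h3 : filteredGram t E - (2 : ℂ) • S + 1 = S * E * S + (S - 1) * (S - 1) := by
    rw [filteredGram, two_smul]
    noncomm_ring
  have he0 : 0 ≤ e := (norm_nonneg _).trans he
  have h4 : ‖S * E * S‖ ≤ 2 * e * 2 :=
    (norm_mul_le _ _).trans (mul_le_mul ((norm_mul_le _ _).trans
      (mul_le_mul hS he (norm_nonneg _) (by norm_num))) hS (norm_nonneg _) (by positivity))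
  have h5 : ‖(S - 1) * (S - 1)‖ ≤ 2 * e * (2 * e) :=
    (norm_mul_le _ _).trans (mul_le_mul h2 h2 (norm_nonneg _) (by positivity))
  rw [h3]
  refine (norm_add_le _ _).trans ?_
  nlinarith

theorem norm_trace_smul_sandwich_le {t a b d : ℝ} (ht0 : 0 ≤ t) (ht1 : t ≤ 1)
    {X D Y W : Matrix ι ι ℂ} (hD : ∑ i, ∑ j, ‖D i j‖ ≤ d) (hX : ‖Xᴴ‖ ≤ a) (hY : ‖Y‖ ≤ b)
    (hW : ∀ i j, ‖W i j‖ ≤ 1) : ‖((t : ℂ) • (X * D * Y) * W).trace‖ ≤ d * (b * a) := by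
  have h0 : 0 ≤ ∑ i, ∑ j, ‖D i j‖ :=
    Finset.sum_nonneg fun _ _ => Finset.sum_nonneg fun _ _ => norm_nonneg _
  rw [Matrix.smul_mul, Matrix.trace_smul, norm_smul, Complex.norm_real, Real.norm_of_nonneg ht0]
  refine (mul_le_of_le_one_left (norm_nonneg _) ht1).trans ?_
  refine (norm_trace_sandwich_le X D Y W hW).trans ?_
  rw [mul_one]
  exact mul_le_mul hD (mul_le_mul hY hX (norm_nonneg _) ((norm_nonneg _).trans hY)) (by positivity)
    (h0.trans hD)

/-- When only the row and the column `m` of `E` change, the traces of the filter and of the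
filtered Gram matrix against a matrix with entries at most `1` change by `O(e)`, whatever the
dimension. -/
theorem norm_trace_sub_mul_le {t e : ℝ} (ht0 : 0 ≤ t) (ht1 : t ≤ 1) {E E' : Matrix ι ι ℂ}
    (hE : Eᴴ = E) (hE' : E'ᴴ = E') (he : ‖E‖ ≤ e) (he' : ‖E'‖ ≤ e) (he1 : e ≤ 3 / 500) (m : ι)
    (hoff : ∀ i j, i ≠ m → j ≠ m → E i j = E' i j) {W : Matrix ι ι ℂ}
    (hW : ∀ i j, ‖W i j‖ ≤ 1) :
    ‖((dataFilter t E - dataFilter t E') * W).trace‖ ≤ 16 * e ∧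
      ‖((filteredGram t E - filteredGram t E') * W).trace‖ ≤ 82 * e := by
  have he0 : 0 ≤ e := (norm_nonneg _).trans he
  have hS := norm_dataFilter_le ht0 ht1 (he.trans (he1.trans (by norm_num)))
  have hS' := norm_dataFilter_le ht0 ht1 (he'.trans (he1.trans (by norm_num)))
  have hSH := dataFilter_conjTranspose t hE
  have hSH' := dataFilter_conjTranspose t hE'
  have hdiff := dataFilter_sub_dataFilter
    (isUnit_one_add_smul ht0 ht1 ((he.trans he1).trans_lt (by norm_num)))
    (isUnit_one_add_smul ht0 ht1 ((he'.trans he1).trans_lt (by norm_num)))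
  have hD : ∑ i, ∑ j, ‖(E - E') i j‖ ≤ 4 * e := by
    have h1 := sum_norm_le_of_eq_off (D := E - E') (by rw [Matrix.conjTranspose_sub, hE, hE']) m
      (fun i j hi hj => by rw [Matrix.sub_apply, hoff i j hi hj, sub_self])
    have h2 := norm_sub_le E E'
    linarith
  have hfil : filteredGram t E - filteredGram t E' =
      (dataFilter t E - dataFilter t E') * ((1 + E) * dataFilter t E) +
        dataFilter t E' * (E - E') * dataFilter t E +
        (dataFilter t E' * (1 + E')) * (dataFilter t E - dataFilter t E') := by
    rw [filteredGram, filteredGram]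
    noncomm_ring
  set S := dataFilter t E
  set S' := dataFilter t E'
  have h1E : ‖(1 : Matrix ι ι ℂ) + E‖ ≤ 41 / 40 :=
    (norm_add_le _ _).trans ((add_le_add linfty_opNorm_one_le he).trans (by linarith))
  have h1E' : ‖(1 : Matrix ι ι ℂ) + E'‖ ≤ 41 / 40 :=
    (norm_add_le _ _).trans ((add_le_add linfty_opNorm_one_le he').trans (by linarith))
  have hY : ‖S' * ((1 + E) * S)‖ ≤ 2 * (41 / 40 * 2) :=
    (norm_mul_le _ _).trans (mul_le_mul hS' ((norm_mul_le _ _).trans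
      (mul_le_mul h1E hS (norm_nonneg _) (by norm_num))) (norm_nonneg _) (by norm_num))
  have hX : ‖(S' * (1 + E') * S)ᴴ‖ ≤ 2 * (41 / 40 * 2) := by
    have : (S' * (1 + E') * S)ᴴ = S * ((1 + E') * S') := by
      rw [Matrix.conjTranspose_mul, Matrix.conjTranspose_mul, hSH, hSH',
        Matrix.conjTranspose_add, Matrix.conjTranspose_one, hE']
    rw [this]
    exact (norm_mul_le _ _).trans (mul_le_mul hS ((norm_mul_le _ _).trans
      (mul_le_mul h1E' hS' (norm_nonneg _) (by norm_num))) (norm_nonneg _) (by norm_num))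
  constructor
  · rw [hdiff, neg_mul, Matrix.trace_neg, norm_neg]
    refine (norm_trace_smul_sandwich_le ht0 ht1 hD (hSH.symm ▸ hS) hS' hW).trans ?_
    linarith
  · have h1 := norm_trace_smul_sandwich_le (X := S) ht0 ht1 hD (hSH.symm ▸ hS) hY hW
    have h2 := norm_trace_smul_sandwich_le (X := S') (Y := S) zero_le_one le_rfl hD
      (hSH'.symm ▸ hS') hS hW
    have h3 := norm_trace_smul_sandwich_le (Y := S') ht0 ht1 hD hX hS' hW
    have heq : (filteredGram t E - filteredGram t E') * W =
        -((t : ℂ) • (S * (E - E') * (S' * ((1 + E) * S))) * W) +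
          ((1 : ℝ) : ℂ) • (S' * (E - E') * S) * W +
          -((t : ℂ) • (S' * (1 + E') * S * (E - E') * S') * W) := by
      rw [hfil, hdiff, Complex.ofReal_one, one_smul]
      simp only [Matrix.add_mul, Matrix.neg_mul, Matrix.mul_neg, Matrix.smul_mul, Matrix.mul_smul,
        Matrix.mul_assoc]
    rw [heq, Matrix.trace_add, Matrix.trace_add, Matrix.trace_neg, Matrix.trace_neg]
    refine (norm_add₃_le).trans ?_
    rw [norm_neg, norm_neg]
    linarith

theorem star_dotProduct_mulVec_eq_trace {κ : Type*} [Fintype κ] (Z : Matrix κ κ ℂ) (y : κ → ℂ) :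
    star y ⬝ᵥ (Z *ᵥ y) = (Z * Matrix.vecMulVec y (star y)).trace := by
  rw [Matrix.mul_vecMulVec, Matrix.trace_vecMulVec, dotProduct_comm]

theorem norm_mulVec_apply_le (Z : Matrix ι ι ℂ) {y : ι → ℂ} (hy : ∀ i, ‖y i‖ ≤ 1) (i : ι) :
    ‖(Z *ᵥ y) i‖ ≤ ‖Z‖ := by
  refine le_trans ?_ (sum_row_norm_le Z i)
  refine (norm_sum_le _ _).trans (Finset.sum_le_sum fun j _ => ?_)
  rw [norm_mul]
  exact mul_le_of_le_one_right (norm_nonneg _) (hy j)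

/-- Moving the sample `m` from a zero of the data (`y m = 0`) to a peak (`|y' m| = 1`) lowers the
cost when the samples are nearly orthogonal: the gain is `1`, and the interactions cost
`O(e (1 + σ²))`. -/
theorem reducedCost_lt {t σ e : ℝ} (ht0 : 0 ≤ t) (ht1 : t ≤ 1) {E E' : Matrix ι ι ℂ}
    (hE : Eᴴ = E) (hE' : E'ᴴ = E') (he : ‖E‖ ≤ e) (he' : ‖E'‖ ≤ e) (he1 : e ≤ 3 / 500)
    (hσe : σ ^ 2 * e ≤ 1 / 1000) (m : ι)
    (hoff : ∀ i j, i ≠ m → j ≠ m → E i j = E' i j) {y y' : ι → ℂ}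
    (hy : ∀ i, ‖y i‖ ≤ 1) (hy' : ∀ i, ‖y' i‖ ≤ 1) (hym : y m = 0) (hym' : ‖y' m‖ = 1)
    (hyoff : ∀ i, i ≠ m → y' i = y i) :
    reducedCost t σ E' y' < reducedCost t σ E y := by
  have he0 : 0 ≤ e := (norm_nonneg _).trans he
  obtain ⟨hS, hF⟩ := norm_trace_sub_mul_le ht0 ht1 hE hE' he he' he1 m hoff
    (W := Matrix.vecMulVec y (star y)) (fun i j => by
      rw [Matrix.vecMulVec_apply, norm_mul, Pi.star_apply, norm_star]
      exact mul_le_one₀ (hy i) (norm_nonneg _) (hy j))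
  obtain ⟨-, hT⟩ := norm_trace_sub_mul_le ht0 ht1 hE hE' he he' he1 m hoff
    (W := 1) (fun i j => by
      rw [Matrix.one_apply]; split_ifs <;> simp)
  have hK := norm_filteredGram_sub_dataFilter_add_one_le ht0 ht1 he' (he1.trans (by norm_num))
  rw [mul_one, Matrix.trace_sub] at hT
  rw [sub_mul, Matrix.trace_sub, ← star_dotProduct_mulVec_eq_trace,
    ← star_dotProduct_mulVec_eq_trace] at hS hF
  have hFH : (filteredGram t E')ᴴ = filteredGram t E' := by
    simp only [filteredGram, Matrix.conjTranspose_mul, Matrix.conjTranspose_add,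
      dataFilter_conjTranspose t hE', hE', Matrix.conjTranspose_one, Matrix.mul_assoc]
  have hSH := dataFilter_conjTranspose t hE'
  -- the part of the quadratic form that is not minus the identity
  set Z := filteredGram t E' - (2 : ℂ) • dataFilter t E' + 1 with hZ
  have hZH : Zᴴ = Z := by
    simp [hZ, hFH, hSH]
  have hKeq : filteredGram t E' - (2 : ℂ) • dataFilter t E' = Z - 1 := by rw [hZ]; abel
  obtain ⟨s, hs⟩ : ∃ s, y' m = s := ⟨_, rfl⟩
  have hyy : y' = y + Pi.single m s := by
    funext i
    by_cases h : i = m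
    · subst h; simp [hym, hs]
    · simp [h, hyoff i h]
  have hsn : ‖s‖ = 1 := by rw [← hs, hym']
  have hnorm : (star y' ⬝ᵥ y').re = (star y ⬝ᵥ y).re + 1 := by
    have h1 : star s * s = 1 := by
      rw [Complex.star_def, mul_comm, Complex.mul_conj, Complex.normSq_eq_norm_sq, hsn]; simp
    rw [hyy, star_add, ← Pi.single_star, add_dotProduct, dotProduct_add, dotProduct_add,
      single_dotProduct, single_dotProduct, dotProduct_single]
    have h2 := congrArg Complex.re h1
    simpa [hym] using h2
  have hcross : star y' ⬝ᵥ (Z *ᵥ y') = star y ⬝ᵥ (Z *ᵥ y) + star s * (Z *ᵥ y') m +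
      star ((Z *ᵥ y) m) * s := by
    have h1 : star y' ⬝ᵥ (Z *ᵥ y') = star y ⬝ᵥ (Z *ᵥ y') + star s * (Z *ᵥ y') m := by
      conv_lhs => rw [hyy, star_add, ← Pi.single_star, add_dotProduct, single_dotProduct, ← hyy]
    have h2 : star y ⬝ᵥ (Z *ᵥ y') = star y ⬝ᵥ (Z *ᵥ y) + star ((Z *ᵥ y) m) * s := by
      rw [hyy, Matrix.mulVec_add, dotProduct_add,
        Matrix.dotProduct_mulVec (star y) Z (Pi.single m s)]
      conv_lhs => rw [← hZH]
      rw [← Matrix.star_mulVec, dotProduct_single, hZH]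
      rfl
    rw [h1, h2]; ring
  have hc1 : ‖star s * (Z *ᵥ y') m‖ ≤ 4 * e + 4 * e ^ 2 := by
    rw [norm_mul, norm_star, hsn, one_mul]
    exact (norm_mulVec_apply_le Z hy' m).trans hK
  have hc2 : ‖star ((Z *ᵥ y) m) * s‖ ≤ 4 * e + 4 * e ^ 2 := by
    rw [norm_mul, norm_star, hsn, mul_one]
    exact (norm_mulVec_apply_le Z hy m).trans hK
  have hq' : (star y' ⬝ᵥ ((filteredGram t E' - (2 : ℂ) • dataFilter t E') *ᵥ y')).re =
      (star y ⬝ᵥ ((filteredGram t E' - (2 : ℂ) • dataFilter t E') *ᵥ y)).re - 1 +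
        (star s * (Z *ᵥ y') m).re + (star ((Z *ᵥ y) m) * s).re := by
    rw [hKeq, Matrix.sub_mulVec, Matrix.sub_mulVec, Matrix.one_mulVec, Matrix.one_mulVec,
      dotProduct_sub, dotProduct_sub, Complex.sub_re, Complex.sub_re, hnorm, hcross,
      Complex.add_re, Complex.add_re]
    ring
  have hsplit : ∀ E₀ : Matrix ι ι ℂ,
      (star y ⬝ᵥ ((filteredGram t E₀ - (2 : ℂ) • dataFilter t E₀) *ᵥ y)).re =
      (star y ⬝ᵥ (filteredGram t E₀ *ᵥ y)).re - 2 * (star y ⬝ᵥ (dataFilter t E₀ *ᵥ y)).re := by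
    intro E₀
    rw [Matrix.sub_mulVec, Matrix.smul_mulVec, dotProduct_sub, dotProduct_smul]
    simp
  rw [reducedCost, reducedCost, hq', hsplit, hsplit]
  have b1 := (abs_le.1 ((Complex.abs_re_le_norm _).trans hc1)).2
  have b2 := (abs_le.1 ((Complex.abs_re_le_norm _).trans hc2)).2
  have b3 := (abs_le.1 ((Complex.abs_re_le_norm _).trans hS)).2
  have b4 := (abs_le.1 ((Complex.abs_re_le_norm _).trans hF)).1
  have b5 := (abs_le.1 ((Complex.abs_re_le_norm _).trans hT)).1
  rw [Complex.sub_re] at b3 b4 b5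
  have b6 := mul_le_mul_of_nonneg_left b5 (sq_nonneg σ)
  -- the gain `1` against `2 (4 e + 4 e²) + 2 * 16 e + 82 e + 82 σ² e`
  nlinarith

end perturbation

/-! ### The Gram matrix and the data of the oscillating signal -/

theorem norm_sub_one_mul_sum_zpow_le {z : ℂ} (hz : ‖z‖ = 1) (K : ℤ) (hK : 0 ≤ K) :
    ‖z - 1‖ * ‖∑ n ∈ Finset.Ico (-K) K, z ^ n‖ ≤ 2 := by
  have hz0 : z ≠ 0 := by rintro rfl; simp at hz
  have h1 : ∑ n ∈ Finset.Ico (-K) K, z ^ n =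
      z ^ (-K) * ∑ k ∈ Finset.range (2 * K).toNat, z ^ k := by
    rw [Finset.mul_sum]
    refine Finset.sum_nbij' (fun n => (n + K).toNat) (fun k => (k : ℤ) - K) ?_ ?_ ?_ ?_ ?_
    · intro n hn
      simp only [Finset.mem_Ico, Finset.mem_range] at hn ⊢
      omega
    · intro k hk
      simp only [Finset.mem_Ico, Finset.mem_range] at hk ⊢
      omega
    · intro n hn
      simp only [Finset.mem_Ico] at hn
      omega
    · intro k hk
      omega
    · intro n hn
      simp only [Finset.mem_Ico] at hn
      rw [← zpow_natCast, ← zpow_add₀ hz0]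
      congr 1
      omega
  have h2 : (z - 1) * ∑ k ∈ Finset.range (2 * K).toNat, z ^ k = z ^ (2 * K).toNat - 1 := by
    rw [mul_comm, geom_sum_mul]
  rw [h1, norm_mul, norm_zpow, hz, one_zpow, one_mul, ← norm_mul, h2]
  refine (norm_sub_le _ _).trans ?_
  rw [norm_pow, hz]; norm_num

theorem le_sin_of_mem_Icc {d θ : ℝ} (hd : 0 ≤ d) (h1 : Real.pi * d ≤ θ)
    (h2 : θ ≤ Real.pi - Real.pi * d) : 2 * d ≤ Real.sin θ := by
  have hpi := Real.pi_pos
  have key : ∀ x, Real.pi * d ≤ x → x ≤ Real.pi / 2 → 2 * d ≤ Real.sin x := by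
    intro x hx hx'
    refine le_trans ?_ (Real.mul_le_sin (le_trans (by positivity) hx) hx')
    rw [div_mul_eq_mul_div, le_div_iff₀ hpi]
    nlinarith
  rcases le_total θ (Real.pi / 2) with h | h
  · exact key θ h1 h
  · rw [← Real.sin_pi_sub]
    exact key _ (by linarith) (by linarith)

section gram
variable {N M : ℕ}

theorem star_vandermondeMat_mul (hN0 : 0 < N) (Ξ : Fin M → ℝ) (n : Grid N) (i j : Fin M) :
    star (vandermondeMat N Ξ n i) * vandermondeMat N Ξ n j =
      (1 / (N : ℂ)) *
        Complex.exp (Complex.I * ((2 * Real.pi * ((Ξ j - Ξ i) / N) : ℝ) : ℂ)) ^ (n : ℤ) := by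
  have hs : (Real.sqrt N : ℂ) * (Real.sqrt N : ℂ) = N := by
    rw [← Complex.ofReal_mul, Real.mul_self_sqrt (Nat.cast_nonneg N), Complex.ofReal_natCast]
  have hs0 : (Real.sqrt N : ℂ) ≠ 0 := by
    exact_mod_cast (Real.sqrt_pos.2 (by exact_mod_cast hN0)).ne'
  rw [← Complex.exp_int_mul]
  simp only [vandermondeMat, Matrix.of_apply, Complex.star_def, map_mul, map_div₀, map_one,
    Complex.conj_ofReal, ← Complex.exp_conj, map_ofNat, Complex.conj_I, map_natCast, map_intCast]
  rw [mul_mul_mul_comm, ← Complex.exp_add, div_mul_div_comm, hs, one_mul]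
  congr 2
  push_cast
  ring

theorem gram_apply (hN0 : 0 < N) (Ξ : Fin M → ℝ) (i j : Fin M) :
    ((vandermondeMat N Ξ)ᴴ * vandermondeMat N Ξ) i j =
      (1 / (N : ℂ)) * ∑ n ∈ Finset.Ico (-((N : ℤ) / 2)) ((N : ℤ) / 2),
        Complex.exp (Complex.I * ((2 * Real.pi * ((Ξ j - Ξ i) / N) : ℝ) : ℂ)) ^ n := by
  rw [Matrix.mul_apply]
  simp only [Matrix.conjTranspose_apply, star_vandermondeMat_mul hN0]
  rw [← Finset.mul_sum]
  congr 1
  exact Finset.sum_coe_sort _ fun n : ℤ =>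
    Complex.exp (Complex.I * ((2 * Real.pi * ((Ξ j - Ξ i) / N) : ℝ) : ℂ)) ^ n

theorem offGram_diag (hN : 2 ∣ N) (hN0 : 0 < N) (Ξ : Fin M → ℝ) (i : Fin M) :
    offGram N Ξ i i = 0 := by
  rw [offGram, Matrix.sub_apply, gram_apply hN0, Matrix.one_apply_eq]
  have hcard : ((Finset.Ico (-((N : ℤ) / 2)) ((N : ℤ) / 2)).card : ℂ) = N := by
    rw [Int.card_Ico]
    norm_cast
    omega
  have hNc : (N : ℂ) ≠ 0 := by exact_mod_cast hN0.ne'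
  simp only [sub_self, zero_div, mul_zero, Complex.ofReal_zero, Complex.exp_zero, one_zpow,
    Finset.sum_const, nsmul_eq_mul, mul_one, hcard]
  rw [one_div_mul_cancel hNc, sub_self]

/-- Decay of the Dirichlet kernel away from the multiples of `N`. -/
theorem norm_offGram_apply_le (hN0 : 0 < N) (Ξ : Fin M → ℝ) {i j : Fin M}
    (hij : i ≠ j) {D : ℝ} (hD : 0 < D) (h1 : D ≤ |Ξ j - Ξ i|) (h2 : |Ξ j - Ξ i| ≤ N - D) :
    ‖offGram N Ξ i j‖ ≤ 1 / (2 * D) := by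
  have hNr : (0 : ℝ) < N := by exact_mod_cast hN0
  rw [offGram, Matrix.sub_apply, gram_apply hN0, Matrix.one_apply_ne hij, sub_zero, norm_mul]
  set z := Complex.exp (Complex.I * ((2 * Real.pi * ((Ξ j - Ξ i) / N) : ℝ) : ℂ)) with hz
  have hz1 : ‖z‖ = 1 := Complex.norm_exp_I_mul_ofReal _
  have hsum := norm_sub_one_mul_sum_zpow_le hz1 ((N : ℤ) / 2) (by omega)
  have hpi := Real.pi_pos
  have hsin : 4 * (D / N) ≤ ‖z - 1‖ := by
    rw [hz, Complex.norm_exp_I_mul_ofReal_sub_one, Real.norm_eq_abs, abs_mul, abs_two]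
    have h3 : 2 * (D / N) ≤ Real.sin |Real.pi * ((Ξ j - Ξ i) / N)| := by
      rw [abs_mul, abs_of_pos hpi, abs_div, abs_of_pos hNr]
      refine le_sin_of_mem_Icc (by positivity) ?_ ?_
      · gcongr
      · have h4 : |Ξ j - Ξ i| / N ≤ 1 - D / N := by
          rw [div_le_iff₀ hNr, sub_mul, div_mul_cancel₀ _ hNr.ne', one_mul]; exact h2
        nlinarith
    have h5 : Real.sin |Real.pi * ((Ξ j - Ξ i) / N)| ≤
        |Real.sin (2 * Real.pi * ((Ξ j - Ξ i) / N) / 2)| := by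
      have : 2 * Real.pi * ((Ξ j - Ξ i) / N) / 2 = Real.pi * ((Ξ j - Ξ i) / N) := by ring
      rw [this]
      rcases abs_cases (Real.pi * ((Ξ j - Ξ i) / N)) with ⟨h, -⟩ | ⟨h, -⟩ <;> rw [h]
      · exact le_abs_self _
      · rw [Real.sin_neg]; exact neg_le_abs _
    linarith
  have h6 := (mul_le_mul_of_nonneg_right hsin (norm_nonneg
    (∑ n ∈ Finset.Ico (-((N : ℤ) / 2)) ((N : ℤ) / 2), z ^ n))).trans hsum
  rw [norm_div, norm_one, Complex.norm_natCast, le_div_iff₀ (by positivity)]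
  have h7 : 4 * (D / N) = 4 * D * (1 / N) := by ring
  rw [h7] at h6
  nlinarith

theorem offGram_congr {Ξ Ξ' : Fin M → ℝ} {i j : Fin M} (hi : Ξ i = Ξ' i) (hj : Ξ j = Ξ' j) :
    offGram N Ξ i j = offGram N Ξ' i j := by
  simp [offGram, Matrix.mul_apply, vandermondeMat, hi, hj]

theorem continuous_vandermondeMat : Continuous fun Ξ : Fin M → ℝ => vandermondeMat N Ξ := by
  refine continuous_matrix fun n m => ?_
  simp only [vandermondeMat, Matrix.of_apply]
  fun_prop

theorem continuous_offGram : Continuous fun Ξ : Fin M → ℝ => offGram N Ξ :=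
  (continuous_vandermondeMat.matrix_conjTranspose.matrix_mul continuous_vandermondeMat).sub
    continuous_const

theorem continuous_data (u : Grid N → ℂ) :
    Continuous fun Ξ : Fin M → ℝ => (vandermondeMat N Ξ)ᴴ *ᵥ u :=
  continuous_vandermondeMat.matrix_conjTranspose.matrix_mulVec continuous_const

/-- The noiseless data. They vanish at the odd integers and have modulus `1` at the even ones. -/
theorem data_oscSignal (hN : 4 ∣ N) (hN0 : 0 < N) (Ξ : Fin M → ℝ) (m : Fin M) :
    ((vandermondeMat N Ξ)ᴴ *ᵥ oscSignal N) m = ((Real.cos (Real.pi * Ξ m / 2) : ℝ) : ℂ) := by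
  obtain ⟨q, rfl⟩ := hN
  have hq : 0 < q := by omega
  have hqc : (q : ℂ) ≠ 0 := by exact_mod_cast hq.ne'
  have hdiv : ((4 * q : ℕ) : ℤ) / 4 = q := by omega
  let a : Grid (4 * q) := ⟨q, by simp only [Finset.mem_Ico]; omega⟩
  let b : Grid (4 * q) := ⟨-q, by simp only [Finset.mem_Ico]; omega⟩
  have hab : a ≠ b := by
    intro h
    have := congrArg Subtype.val h
    simp only [a, b] at this
    omega
  have hzero : ∀ n : Grid (4 * q), n ≠ a ∧ n ≠ b →
      (vandermondeMat (4 * q) Ξ)ᴴ m n * oscSignal (4 * q) n = 0 := by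
    rintro n ⟨h1, h2⟩
    have h3 : ¬((n : ℤ) = ((4 * q : ℕ) : ℤ) / 4 ∨ (n : ℤ) = -(((4 * q : ℕ) : ℤ) / 4)) := by
      rw [hdiv]
      rintro (h | h)
      · exact h1 (Subtype.ext h)
      · exact h2 (Subtype.ext h)
    rw [oscSignal, if_neg h3, mul_zero]
  have ha : oscSignal (4 * q) a = ((Real.sqrt (4 * q : ℕ) / 2 : ℝ) : ℂ) := by
    rw [oscSignal, if_pos (Or.inl hdiv.symm)]
  have hb : oscSignal (4 * q) b = ((Real.sqrt (4 * q : ℕ) / 2 : ℝ) : ℂ) := by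
    rw [oscSignal, if_pos (Or.inr (by rw [hdiv]))]
  rw [Matrix.mulVec, dotProduct, Fintype.sum_eq_add a b hab hzero, ha, hb]
  simp only [Matrix.conjTranspose_apply, vandermondeMat, Matrix.of_apply, Complex.star_def,
    map_mul, map_div₀, map_one, Complex.conj_ofReal, ← Complex.exp_conj, map_ofNat,
    Complex.conj_I, map_natCast, map_intCast, a, b]
  have e1 : 2 * -Complex.I * (Real.pi : ℂ) * ((Ξ m : ℂ) * (((q : ℤ) : ℂ) / ((4 * q : ℕ) : ℂ))) =
      -((Real.pi * Ξ m / 2 : ℝ) : ℂ) * Complex.I := by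
    push_cast; field_simp; ring
  have e2 : 2 * -Complex.I * (Real.pi : ℂ) *
      ((Ξ m : ℂ) * (((-q : ℤ) : ℂ) / ((4 * q : ℕ) : ℂ))) =
      ((Real.pi * Ξ m / 2 : ℝ) : ℂ) * Complex.I := by
    push_cast; field_simp; ring
  rw [e1, e2, Complex.ofReal_cos, Complex.cos]
  simp only [Complex.ofReal_div, Complex.ofReal_ofNat]
  field_simp
  ring

end gram

theorem continuousOn_reducedCost {X ι : Type*} [TopologicalSpace X] [Fintype ι] [DecidableEq ι]
    (t σ : ℝ) {s : Set X} {E : X → Matrix ι ι ℂ} {y : X → ι → ℂ} (hE : Continuous E)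
    (hy : Continuous y) (hs : ∀ x ∈ s, IsUnit (1 + (t : ℂ) • E x)) :
    ContinuousOn (fun x => reducedCost t σ (E x) (y x)) s := by
  have h1 : Continuous fun x => 1 + (t : ℂ) • E x := 
    continuous_const.add (hE.const_smul (t : ℂ))
  have hS : ContinuousOn (fun x => dataFilter t (E x)) s := by
    simp only [dataFilter, Matrix.inv_def, Ring.inverse_eq_inv']
    refine ContinuousOn.smul (h1.matrix_det.continuousOn.inv₀ fun x hx => ?_)
      h1.matrix_adjugate.continuousOn
    exact ((Matrix.isUnit_iff_isUnit_det _).mp (hs x hx)).ne_zero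
  have hF : ContinuousOn (fun x => filteredGram t (E x)) s :=
    (hS.mul (continuous_const.add hE).continuousOn).mul hS
  rw [continuousOn_iff_continuous_domRestrict] at hS hF ⊢
  have hy' : Continuous (s.domRestrict y) := hy.comp continuous_subtype_val
  have hq : Continuous fun x : s => (star (y x) ⬝ᵥ
      ((filteredGram t (E x) - (2 : ℂ) • dataFilter t (E x)) *ᵥ y x)) :=
    Continuous.dotProduct hy'.star ((hF.sub (hS.const_smul (2 : ℂ))).matrix_mulVec hy')
  exact (Complex.continuous_re.comp hq).add
    (continuous_const.mul (Complex.continuous_re.comp hF.matrix_trace))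

/-! ### A local minimizer in each box of well-separated samples -/

/-- A continuous function on a cube has an interior local minimizer when, from each point of the
boundary, recentring one coordinate lowers the function. -/
theorem exists_isLocalMin_of_recentring {M : ℕ} {f : (Fin M → ℝ) → ℝ} {k : Fin M → ℝ}
    (hf : ContinuousOn f {Ξ | ∀ m, |Ξ m - k m| ≤ 1})
    (hb : ∀ Ξ, (∀ m, |Ξ m - k m| ≤ 1) → ∀ m, |Ξ m - k m| = 1 →
      f (Function.update Ξ m (k m)) < f Ξ) :
    ∃ Ξ, (∀ m, |Ξ m - k m| < 1) ∧ IsLocalMin f Ξ := by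
  have hbox : {Ξ : Fin M → ℝ | ∀ m, |Ξ m - k m| ≤ 1} =
      Set.univ.pi fun m => Set.Icc (k m - 1) (k m + 1) := by
    ext Ξ
    simp only [Set.mem_ofPred_eq, Set.mem_pi, Set.mem_univ, true_implies, Set.mem_Icc]
    refine forall_congr' fun m => ?_
    rw [abs_le]
    constructor <;> rintro ⟨h1, h2⟩ <;> constructor <;> linarith
  have hcomp : IsCompact {Ξ : Fin M → ℝ | ∀ m, |Ξ m - k m| ≤ 1} := by
    rw [hbox]
    exact isCompact_univ_pi fun m => isCompact_Icc
  obtain ⟨Ξ, hΞ, hmin⟩ := hcomp.exists_isMinOn ⟨k, fun m => by simp⟩ hf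
  have hlt : ∀ m, |Ξ m - k m| < 1 := by
    intro m
    refine lt_of_le_of_ne (hΞ m) fun heq => ?_
    refine absurd (hmin (a := Function.update Ξ m (k m)) fun m' => ?_)
      (not_le.2 (hb Ξ hΞ m heq))
    by_cases h : m' = m
    · subst h; simp
    · rw [Function.update_of_ne h]; exact hΞ m'
  refine ⟨Ξ, hlt, ?_⟩
  have hopen : IsOpen {Ξ : Fin M → ℝ | ∀ m, |Ξ m - k m| < 1} := by
    rw [Set.ofPred_forall]
    refine isOpen_iInter_of_finite fun m => isOpen_lt (by fun_prop) continuous_const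
  filter_upwards [hopen.mem_nhds hlt] with Ξ' hΞ'
  exact hmin fun m => (hΞ' m).le

section norm

attribute [local instance] Matrix.linftyOpNormedAddCommGroup Matrix.linftyOpNormedRing
  Matrix.linftyOpNormedAlgebra

theorem norm_offGram_le {N M : ℕ} (hN : 2 ∣ N) (hN0 : 0 < N) {e D : ℝ} (hD : 0 < D) (he0 : 0 ≤ e)
    (he : ((M : ℝ) - 1) / (2 * D) ≤ e) (Ξ : Fin M → ℝ)
    (hsep : ∀ i j, i ≠ j → D ≤ |Ξ j - Ξ i| ∧ |Ξ j - Ξ i| ≤ N - D) : ‖offGram N Ξ‖ ≤ e := by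
  refine linfty_opNorm_le he0 fun i => ?_
  rw [← Finset.add_sum_erase _ _ (Finset.mem_univ i), offGram_diag hN hN0, norm_zero, zero_add]
  refine (Finset.sum_le_card_nsmul _ _ (1 / (2 * D)) fun j hj => ?_).trans ?_
  · have hij := (Finset.ne_of_mem_erase hj).symm
    exact norm_offGram_apply_le hN0 Ξ hij hD (hsep i j hij).1 (hsep i j hij).2
  · have hM : 1 ≤ M := Nat.one_le_of_lt i.2
    rw [Finset.card_erase_of_mem (Finset.mem_univ i), Finset.card_univ, Fintype.card_fin,
      nsmul_eq_mul, Nat.cast_sub hM, Nat.cast_one, mul_one_div]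
    exact he

/-- The cube of half-width one around well-separated even integers `k m` contains a local
minimizer: on a face of the cube the sample concerned sits at an odd integer, where the data
vanish, and recentring it lowers the cost. -/
theorem exists_isLocalMin_cost {N M : ℕ} (hN : 4 ∣ N) (hN0 : 0 < N) {t σ e D : ℝ} (ht0 : 0 ≤ t)
    (ht1 : t ≤ 1) {R : (Fin M → ℝ) → (Fin M → ℂ) → Grid N → ℂ}
    (hR : ∀ Ξ : Fin M → ℝ, IsUnit (1 + (t : ℂ) • offGram N Ξ) → ∀ y,
      R Ξ y = (vandermondeMat N Ξ * dataFilter t (offGram N Ξ)) *ᵥ y)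
    (hD : 0 < D) (he0 : 0 ≤ e) (he : ((M : ℝ) - 1) / (2 * D) ≤ e) (he1 : e ≤ 3 / 500)
    (hσe : σ ^ 2 * e ≤ 1 / 1000) {k : Fin M → ℝ} (hk : ∀ m, ∃ n : ℤ, k m = 2 * n)
    (hsep : ∀ i j, i ≠ j → D + 2 ≤ |k j - k i| ∧ |k j - k i| ≤ N - (D + 2)) :
    ∃ Ξ, (∀ m, |Ξ m - k m| < 1) ∧ IsLocalMin (cost R (oscSignal N) σ) Ξ := by
  have hN2 : 2 ∣ N := (by norm_num : 2 ∣ 4).trans hN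
  have hE : ∀ Ξ : Fin M → ℝ, (∀ m, |Ξ m - k m| ≤ 1) → ‖offGram N Ξ‖ ≤ e := by
    intro Ξ hΞ
    refine norm_offGram_le hN2 hN0 hD he0 he Ξ fun i j hij => ?_
    have h1 := hΞ i
    have h2 := hΞ j
    obtain ⟨h3, h4⟩ := hsep i j hij
    have h5 : |(Ξ j - Ξ i) - (k j - k i)| ≤ 2 := by
      have : (Ξ j - Ξ i) - (k j - k i) = (Ξ j - k j) - (Ξ i - k i) := by ring
      rw [this]
      exact (abs_sub _ _).trans (by linarith)
    have h6 := abs_sub_abs_le_abs_sub (Ξ j - Ξ i) (k j - k i)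
    have h7 := abs_sub_abs_le_abs_sub (k j - k i) (Ξ j - Ξ i)
    rw [abs_sub_comm (k j - k i)] at h7
    constructor <;> linarith
  have hunit : ∀ Ξ : Fin M → ℝ, (∀ m, |Ξ m - k m| ≤ 1) →
      IsUnit (1 + (t : ℂ) • offGram N Ξ) := fun Ξ hΞ =>
    isUnit_one_add_smul ht0 ht1 (((hE Ξ hΞ).trans he1).trans_lt (by norm_num))
  have hcost : ∀ Ξ : Fin M → ℝ, (∀ m, |Ξ m - k m| ≤ 1) → cost R (oscSignal N) σ Ξ =
      1 / 2 * sqNorm (oscSignal N) + 1 / 2 * reducedCost t σ (offGram N Ξ)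
        ((vandermondeMat N Ξ)ᴴ *ᵥ oscSignal N) := fun Ξ hΞ =>
    cost_eq_reducedCost (hR Ξ (hunit Ξ hΞ)) _ _
  refine exists_isLocalMin_of_recentring ?_ ?_
  · refine ContinuousOn.congr ?_ hcost
    exact continuousOn_const.add (continuousOn_const.mul
      (continuousOn_reducedCost t σ continuous_offGram (continuous_data _) hunit))
  · intro Ξ hΞ m hm
    have hΞ' : ∀ m', |Function.update Ξ m (k m) m' - k m'| ≤ 1 := by
      intro m'
      by_cases h : m' = m
      · subst h; simp
      · rw [Function.update_of_ne h]; exact hΞ m'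
    have hy : ∀ (Ξ₀ : Fin M → ℝ) i, ‖((vandermondeMat N Ξ₀)ᴴ *ᵥ oscSignal N) i‖ ≤ 1 := by
      intro Ξ₀ i
      rw [data_oscSignal hN hN0, Complex.norm_real]
      exact Real.abs_cos_le_one _
    obtain ⟨n, hn⟩ := hk m
    rw [hcost Ξ hΞ, hcost _ hΞ']
    have hlt := reducedCost_lt (σ := σ) ht0 ht1 (offGram_conjTranspose N Ξ)
      (offGram_conjTranspose N (Function.update Ξ m (k m))) (hE Ξ hΞ) (hE _ hΞ') he1 hσe m
      (fun i j hi hj => offGram_congr (Function.update_of_ne hi _ _).symm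
        (Function.update_of_ne hj _ _).symm)
      (hy Ξ) (hy (Function.update Ξ m (k m))) ?_ ?_ ?_
    · linarith
    · rw [data_oscSignal hN hN0, Complex.ofReal_eq_zero, Real.cos_eq_zero_iff]
      rcases (abs_eq zero_le_one).1 hm with h | h
      · refine ⟨n, ?_⟩
        rw [sub_eq_iff_eq_add.1 h, hn]; ring
      · refine ⟨n - 1, ?_⟩
        rw [sub_eq_iff_eq_add.1 h, hn]; push_cast; ring
    · rw [data_oscSignal hN hN0, Complex.norm_real, Function.update_self, hn, Real.norm_eq_abs]
      have : Real.pi * (2 * (n : ℝ)) / 2 = n * Real.pi := by ring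
      rw [this, Real.abs_cos_int_mul_pi]
    · intro i hi
      rw [data_oscSignal hN hN0, data_oscSignal hN hN0, Function.update_of_ne hi]

end norm

/-! ### Counting the boxes -/

/-- The position, counted in even integers from `-N/2`, of the sample `m`: it lies in the block
number `π m` (of `B` even integers), at the place `f m + 1` within the first `L` of them. -/
def blockPos {M : ℕ} (B L : ℕ) (c : Equiv.Perm (Fin M) × (Fin M → Fin L)) (m : Fin M) : ℕ :=
  (c.1 m : ℕ) * B + c.2 m + 1

theorem blockPos_le {M B L : ℕ} (c : Equiv.Perm (Fin M) × (Fin M → Fin L)) (m : Fin M) :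
    1 ≤ blockPos B L c m ∧ blockPos B L c m + B ≤ M * B + L := by
  have h1 : ((c.1 m : ℕ) + 1) * B ≤ M * B := Nat.mul_le_mul_right _ (c.1 m).2
  have h2 := (c.2 m).2
  rw [add_mul, one_mul] at h1
  unfold blockPos
  constructor <;> omega

theorem blockPos_injective {M B L : ℕ} (hLB : L ≤ B) :
    Function.Injective (blockPos B L : _ → Fin M → ℕ) := by
  rintro ⟨p, f⟩ ⟨p', f'⟩ h
  have key : ∀ m, p m = p' m ∧ f m = f' m := by
    intro m
    have hm := congrFun h m
    simp only [blockPos, add_left_inj] at hm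
    have h1 : (f m : ℕ) < B := (f m).2.trans_le hLB
    have h2 : (f' m : ℕ) < B := (f' m).2.trans_le hLB
    have hB : 0 < B := by omega
    have h3 := congrArg (· / B) hm
    have h4 := congrArg (· % B) hm
    simp only [Nat.mul_comm _ B, Nat.mul_add_div hB, Nat.mul_add_mod, Nat.div_eq_of_lt h1,
      Nat.div_eq_of_lt h2, Nat.mod_eq_of_lt h1, Nat.mod_eq_of_lt h2, add_zero] at h3 h4
    exact ⟨Fin.ext h3, Fin.ext h4⟩
  exact Prod.ext (Equiv.ext fun m => (key m).1) (funext fun m => (key m).2)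

/-- Two samples are separated by at least `B - L + 1` even integers, also cyclically. -/
theorem blockPos_separated {M B L : ℕ} (hLB : L ≤ B)
    (c : Equiv.Perm (Fin M) × (Fin M → Fin L)) {i j : Fin M} (hij : i ≠ j) :
    (B : ℤ) - L + 1 ≤ |(blockPos B L c j : ℤ) - blockPos B L c i| ∧
      |(blockPos B L c j : ℤ) - blockPos B L c i| ≤ M * B - (B - L + 1) := by
  wlog hlt : c.1 i < c.1 j generalizing i j
  · have hne : c.1 i ≠ c.1 j := fun h => hij (c.1.injective h)
    have := this hij.symm (lt_of_le_of_ne (not_lt.1 hlt) hne.symm)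
    rwa [abs_sub_comm] at this
  have h1 : ((c.1 i : ℕ) + 1) * B ≤ (c.1 j : ℕ) * B := Nat.mul_le_mul_right _ hlt
  have h2 : ((c.1 j : ℕ) + 1) * B ≤ M * B := Nat.mul_le_mul_right _ (c.1 j).2
  have h3 := (c.2 i).2
  have h4 := (c.2 j).2
  rw [add_mul, one_mul] at h1 h2
  have h0 : (blockPos B L c i : ℤ) ≤ blockPos B L c j := by
    unfold blockPos; omega
  rw [abs_of_nonneg (by linarith)]
  have h5 : ((M : ℤ) * B) = ((M * B : ℕ) : ℤ) := by push_cast; rfl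
  rw [h5]
  unfold blockPos
  constructor <;> omega

/-- The count of local minimizers, for each member of the family of reconstructors. -/
theorem hasMoreThan_localMinimizers_cost {N M : ℕ} (hN : 4 ∣ N) {t σ η : ℝ} (ht0 : 0 ≤ t)
    (ht1 : t ≤ 1) {R : (Fin M → ℝ) → (Fin M → ℂ) → Grid N → ℂ}
    (hR : ∀ Ξ : Fin M → ℝ, IsUnit (1 + (t : ℂ) • offGram N Ξ) → ∀ y,
      R Ξ y = (vandermondeMat N Ξ * dataFilter t (offGram N Ξ)) *ᵥ y)
    (hη : 0 < η) (hη1 : η ≤ 109 / 1000) (hση : σ ^ 2 * η ^ 2 ≤ 1 / 500)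
    (hM : M = ⌊η * Real.sqrt N⌋₊) (hM1 : 1 ≤ M) :
    HasMoreThan (localMinimizers N (cost R (oscSignal N) σ))
      ((M.factorial : ℝ) * (1 / (2 * η)) ^ (η * Real.sqrt N)) := by
  have hMle : (M : ℝ) ≤ η * Real.sqrt N := by
    rw [hM]; exact Nat.floor_le (by positivity)
  have hMlt : η * Real.sqrt N < M + 1 := by
    rw [hM]; exact Nat.lt_floor_add_one _
  have hMr : (1 : ℝ) ≤ M := by exact_mod_cast hM1
  set a : ℝ := (1 / (2 * η)) ^ 2 with ha
  have haη : 4 * η ^ 2 * a = 1 := by rw [ha]; field_simp; norm_num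
  have hη2 : η ^ 2 ≤ (109 / 1000) ^ 2 := pow_le_pow_left₀ hη.le hη1 2
  have ha0 : 0 < a := by positivity
  have ha21 : 21 ≤ a := by nlinarith
  -- `N` is large because `η √N ≥ M`
  have hNM : 4 * a * (M : ℝ) ^ 2 ≤ N := by
    have h1 : (M : ℝ) ^ 2 ≤ (η * Real.sqrt N) ^ 2 := pow_le_pow_left₀ (by positivity) hMle 2
    rw [mul_pow, Real.sq_sqrt (Nat.cast_nonneg N)] at h1
    calc 4 * a * (M : ℝ) ^ 2 ≤ 4 * a * (η ^ 2 * N) := by gcongr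
      _ = 4 * η ^ 2 * a * N := by ring
      _ = N := by rw [haη, one_mul]
  have hN0 : 0 < N := by
    have : (0 : ℝ) < N := lt_of_lt_of_le (by positivity) hNM
    exact_mod_cast this
  obtain ⟨q, hq⟩ := hN
  have hqr : (N : ℝ) = 4 * q := by rw [hq]; push_cast; ring
  -- `M` blocks of `B` even integers each, of which the first `L` are used
  set B : ℕ := 2 * q / M with hB
  set L : ℕ := ⌊a⌋₊ + 1 with hL
  have hMB : M * B ≤ 2 * q := Nat.mul_div_le _ _
  have hMBr : 2 * (q : ℝ) < M * (B + 1) := by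
    have h := Nat.lt_mul_div_succ (2 * q) (show 0 < M by omega)
    have h' : ((2 * q : ℕ) : ℝ) < ((M * (2 * q / M + 1) : ℕ) : ℝ) := by exact_mod_cast h
    push_cast at h'
    rw [hB]; exact h'
  have hBr : 2 * a * M < B + 1 := by
    have h1 : (M : ℝ) * (2 * a * M) < M * (B + 1) := by nlinarith
    exact lt_of_mul_lt_mul_left h1 (by positivity)
  have hLr : (L : ℝ) ≤ a + 1 := by
    rw [hL]; push_cast; linarith [Nat.floor_le ha0.le]
  have hLa : a < L := by
    rw [hL]; push_cast; exact Nat.lt_floor_add_one a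
  have hLB : L + 1 ≤ B := by
    have : (L : ℝ) + 1 < B + 1 := by nlinarith
    have h2 : L + 1 < B + 1 := by exact_mod_cast this
    omega
  have hLBr : (L : ℝ) + 1 ≤ B := by exact_mod_cast hLB
  have hDpos : (0 : ℝ) < 2 * (B - L) := by linarith
  have he : ((M : ℝ) - 1) / (2 * (2 * (B - L))) ≤ η ^ 2 / 2 := by
    rw [div_le_iff₀ (by positivity)]
    have h1 : 2 * a * ((M : ℝ) - 1) ≤ B - L := by linarith
    have h2 : 2 * η ^ 2 * (2 * a * ((M : ℝ) - 1)) ≤ 2 * η ^ 2 * (B - L) := by gcongr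
    have h3 : 2 * η ^ 2 * (2 * a * ((M : ℝ) - 1)) = 4 * η ^ 2 * a * ((M : ℝ) - 1) := by ring
    rw [h3, haη] at h2
    linarith
  have hex : ∀ c : Equiv.Perm (Fin M) × (Fin M → Fin L), ∃ Ξ : Fin M → ℝ,
      (∀ m, |Ξ m - 2 * ((blockPos B L c m : ℝ) - q)| < 1) ∧
        IsLocalMin (cost R (oscSignal N) σ) Ξ := by
    intro c
    -- `-N/2 = -2 q` is even, so the samples are even integers
    refine exists_isLocalMin_cost (e := η ^ 2 / 2) ⟨q, hq⟩ hN0 ht0 ht1 hR hDpos (by positivity) he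
      (by linarith) (by linarith) (fun m => ⟨(blockPos B L c m : ℤ) - q, by push_cast; rfl⟩) ?_
    intro i j hij
    obtain ⟨h1, h2⟩ := blockPos_separated (by omega : L ≤ B) c hij
    have h1r : (B : ℝ) - L + 1 ≤ |(blockPos B L c j : ℝ) - blockPos B L c i| := by
      exact_mod_cast h1
    have h2r : |(blockPos B L c j : ℝ) - blockPos B L c i| ≤ M * B - (B - L + 1) := by
      exact_mod_cast h2
    have hMB' : (M : ℝ) * B ≤ 2 * q := by exact_mod_cast hMB
    have h3 : 2 * ((blockPos B L c j : ℝ) - q) - 2 * ((blockPos B L c i : ℝ) - q) =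
        2 * ((blockPos B L c j : ℝ) - blockPos B L c i) := by ring
    rw [h3, abs_mul, abs_two, hqr]
    constructor <;> linarith
  choose Ξ hΞ hmin using hex
  have hinj : Function.Injective Ξ := by
    intro c c' h
    refine blockPos_injective (by omega : L ≤ B) (funext fun m => ?_)
    have h1 := abs_lt.1 (hΞ c m)
    have h2 := abs_lt.1 (hΞ c' m)
    rw [← h] at h2
    have h3 : (blockPos B L c m : ℝ) < blockPos B L c' m + 1 := by linarith
    have h4 : (blockPos B L c' m : ℝ) < blockPos B L c m + 1 := by linarith
    have h3' : blockPos B L c m < blockPos B L c' m + 1 := by exact_mod_cast h3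
    have h4' : blockPos B L c' m < blockPos B L c m + 1 := by exact_mod_cast h4
    omega
  refine ⟨Finset.univ.map ⟨Ξ, hinj⟩, ?_, ?_⟩
  · intro x hx
    obtain ⟨c, -, rfl⟩ := Finset.mem_map.1 (Finset.mem_coe.1 hx)
    refine ⟨hmin c, fun m => ?_⟩
    have h1 := abs_lt.1 (hΞ c m)
    obtain ⟨h2, h3⟩ := blockPos_le (B := B) c m
    have h2r : (1 : ℝ) ≤ blockPos B L c m := by exact_mod_cast h2
    have h3r : (blockPos B L c m : ℝ) + 1 ≤ 2 * q := by
      have : blockPos B L c m + 1 ≤ 2 * q := by omega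
      exact_mod_cast this
    rw [hqr, Function.Embedding.coeFn_mk]
    constructor <;> linarith
  · rw [Finset.card_map, Finset.card_univ, Fintype.card_prod, Fintype.card_perm, Fintype.card_pi,
      Finset.prod_const, Finset.card_univ, Fintype.card_fin, Fintype.card_fin, Nat.cast_mul,
      Nat.cast_pow]
    refine mul_lt_mul_of_pos_left ?_ (by exact_mod_cast M.factorial_pos)
    have hb : 1 ≤ 1 / (2 * η) := by
      rw [le_div_iff₀ (by positivity)]; linarith
    -- the fractional part of `η √N` costs one factor, absorbed since `M + 1 ≤ 2 M`
    calc (1 / (2 * η)) ^ (η * Real.sqrt N) ≤ (1 / (2 * η)) ^ (((2 * M : ℕ) : ℝ)) := by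
          refine Real.rpow_le_rpow_of_exponent_le hb ?_
          push_cast; linarith
      _ = a ^ M := by rw [Real.rpow_natCast, pow_mul]
      _ < (L : ℝ) ^ M := pow_lt_pow_left₀ hLa ha0.le (by omega)

/-- A single smallness condition on `η` and `σ η` serves the three reconstructors. -/
theorem hasMoreThan_localMinimizers {N M : ℕ} (hN : 4 ∣ N) {σ η : ℝ} (hη : 0 < η)
    (hη1 : η ≤ 109 / 1000) (hση : σ ^ 2 * η ^ 2 ≤ 1 / 500) (hM : M = ⌊η * Real.sqrt N⌋₊)
    (hM1 : 1 ≤ M) :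
    HasMoreThan (localMinimizers N (J₁ M (oscSignal N) σ))
        ((M.factorial : ℝ) * (1 / (2 * η)) ^ (η * Real.sqrt N)) ∧
      HasMoreThan (localMinimizers N (J₂ M (oscSignal N) σ))
        ((M.factorial : ℝ) * (1 / (2 * η)) ^ (η * Real.sqrt N)) ∧
      ∀ lam : ℝ, 0 < lam →
        HasMoreThan (localMinimizers N (J₃ M (oscSignal N) σ lam))
          ((M.factorial : ℝ) * (1 / (2 * η)) ^ (η * Real.sqrt N)) := by
  refine ⟨?_, ?_, fun lam hlam => ?_⟩
  · exact hasMoreThan_localMinimizers_cost hN le_rfl zero_le_one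
      (fun Ξ _ y => backProj_eq_filtered N Ξ y) hη hη1 hση hM hM1
  · exact hasMoreThan_localMinimizers_cost hN zero_le_one le_rfl
      (fun Ξ h y => pinvRec_eq_filtered N Ξ y h) hη hη1 hση hM hM1
  · exact hasMoreThan_localMinimizers_cost hN (by positivity)
      (by rw [div_le_one (by positivity)]; linarith)
      (fun Ξ h y => tikhonovRec_eq_filtered hlam N Ξ y h) hη hη1 hση hM hM1

theorem corollary1 (N : ℕ) (hN : 4 ∣ N) (σ : ℝ) (hσ : 0 ≤ σ) :
    -- the general bound
    (∀ (η : ℝ) (M : ℕ), η = Real.pi ^ 2 * Real.sqrt 2 / (256 * (20 + 16 * σ ^ 2)) →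
      M = ⌊η * Real.sqrt N⌋₊ → 1 ≤ M →
        HasMoreThan (localMinimizers N (J₁ M (oscSignal N) σ))
          ((M.factorial : ℝ) * (1 / (2 * η)) ^ (η * Real.sqrt N)) ∧
        HasMoreThan (localMinimizers N (J₂ M (oscSignal N) σ))
          ((M.factorial : ℝ) * (1 / (2 * η)) ^ (η * Real.sqrt N)) ∧
        ∀ lam : ℝ, 0 < lam →
          HasMoreThan (localMinimizers N (J₃ M (oscSignal N) σ lam))
            ((M.factorial : ℝ) * (1 / (2 * η)) ^ (η * Real.sqrt N))) ∧
    -- the noise levels at most one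
    (∀ (η : ℝ) (M : ℕ), σ ≤ 1 → η = 3 / 1000 →
      M = ⌊η * Real.sqrt N⌋₊ → 1 ≤ M →
        HasMoreThan (localMinimizers N (J₁ M (oscSignal N) σ))
          ((M.factorial : ℝ) * (1 / (2 * η)) ^ (η * Real.sqrt N)) ∧
        HasMoreThan (localMinimizers N (J₂ M (oscSignal N) σ))
          ((M.factorial : ℝ) * (1 / (2 * η)) ^ (η * Real.sqrt N)) ∧
        ∀ lam : ℝ, 0 < lam →
          HasMoreThan (localMinimizers N (J₃ M (oscSignal N) σ lam))
            ((M.factorial : ℝ) * (1 / (2 * η)) ^ (η * Real.sqrt N))) ∧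
    -- noiseless back-projection
    (∀ (η : ℝ) (M : ℕ), σ = 0 → η = 109 / 1000 →
      M = ⌊η * Real.sqrt N⌋₊ → 1 ≤ M →
        HasMoreThan (localMinimizers N (J₁ M (oscSignal N) σ))
          ((M.factorial : ℝ) * (1 / (2 * η)) ^ (η * Real.sqrt N))) := by
  refine ⟨?_, ?_, ?_⟩
  · intro η M hη hM hM1
    have hc0 : 0 < Real.pi ^ 2 * Real.sqrt 2 := by have := Real.pi_pos; positivity
    have hc : Real.pi ^ 2 * Real.sqrt 2 ≤ 16 := by
      have h1 : Real.pi ^ 2 ≤ 10 := by nlinarith [Real.pi_lt_d2, Real.pi_pos]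
      have h2 : Real.sqrt 2 ≤ 3 / 2 := Real.sqrt_le_iff.2 ⟨by norm_num, by norm_num⟩
      nlinarith [Real.sqrt_nonneg 2]
    have hηc : η * (256 * (20 + 16 * σ ^ 2)) = Real.pi ^ 2 * Real.sqrt 2 := by
      rw [hη]; exact div_mul_cancel₀ _ (by positivity)
    have hη0 : 0 < η := by rw [hη]; positivity
    have hs : 0 ≤ η * σ ^ 2 := by positivity
    have h1 : η ≤ 1 / 320 := by linarith
    have h2 : η * σ ^ 2 ≤ 1 / 256 := by linarith
    refine hasMoreThan_localMinimizers hN hη0 (by linarith) ?_ hM hM1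
    have h3 : σ ^ 2 * η ^ 2 = η * σ ^ 2 * η := by ring
    rw [h3]
    calc η * σ ^ 2 * η ≤ 1 / 256 * (1 / 320) := mul_le_mul h2 h1 hη0.le (by norm_num)
      _ ≤ 1 / 500 := by norm_num
  · intro η M hσ1 hη hM hM1
    have h1 : σ ^ 2 ≤ 1 := pow_le_one₀ hσ hσ1
    exact hasMoreThan_localMinimizers hN (by rw [hη]; norm_num) (by rw [hη]; norm_num)
      (by rw [hη]; linarith) hM hM1
  · intro η M hσ0 hη hM hM1
    exact (hasMoreThan_localMinimizers hN (by rw [hη]; norm_num) (by rw [hη])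
      (by rw [hσ0, hη]; norm_num) hM hM1).1
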